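/- Let $\hbar>0$. On $L^2(\mathbb R)$ consider, for $\ell_g>0$, the Gaussian position-dephasing channel $$\Delta_g(\rho)=\int_{\mathbb R}\tilde g(p)\,e^{ip\hat X/\hbar}\rho\,e^{-ip\hat X/\hbar}\,dp,\qquad \tilde g(p)=\frac{1}{\sqrt{2\pi}\,\eta}e^{-p^2/2\eta^2},\quad \eta=\hbar/\ell_g,$$ and the $l_2$ dephasing loss $C_2^g(\rho)=\|\rho\|_2^2-\|\Delta_g(\rho)\|_2^2$, where $\|\cdot\|_2$ is the Hilbert–Schmidt norm. A Gaussian wavepacket of width $\sigma>0$ is $$\psi(x)=(2\pi\sigma^2)^{-1/4}\exp\!\Big[-\tfrac{(x-c)^2}{4\sigma^2}+i\big(\alpha(x-c)^2+\beta(x-c)+\gamma\big)\Big],\qquad c,\alpha,\beta,\gamma\in\mathbb R.$$ (i) In position representation $\Delta_g$ multiplies the kernel by $g(x-y)$ with $g(\xi)=e^{-\xi^2/2\ell_g^2}$: for all $\psi,\varphi\in L^2(\mathbb R)$ and almost every $x$, $(\Delta_g(|\psi\rangle\langle\psi|)\varphi)(x)=\int g(x-y)\,\psi(x)\overline{\psi(y)}\,\varphi(y)\,dy$.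 (ii) For every Gaussian wavepacket of width $\sigma$ (in particular for $\alpha=\beta=\gamma=0$), $$C_2^g(|\psi\rangle\langle\psi|)=1-\frac1{\sqrt{1+4\sigma^2/\ell_g^2}}.$$ (iii) This value is strictly increasing in $\sigma/\ell_g$, tends to $0$ as $\sigma/\ell_g\to0$ and to $1$ as $\sigma/\ell_g\to\infty$. (iv) Let $G,m,M,x_0,\sigma_0>0$, let $V(x)=-GmM/x$, let $V_2$ be its second-order Taylor polynomial at $x_0$, and let $\kappa=\sqrt{2GM/x_0^3}$. There is exactly one family $(\psi_t)_{t\in\mathbb R}$ of unit vectors of $L^2(\mathbb R)$ that solves $i\hbar\,\partial_t\psi=-\frac{\hbar^2}{2m}\partial_x^2\psi+V_2\psi$ weakly (tested against Schwartz functions of $x$) with $\psi_0(x)=(2\pi\sigma_0^2)^{-1/4}e^{-(x-x_0)^2/4\sigma_0^2}$. For every $t$, $\psi_t$ is a Gaussian wavepacket centred at the classical position $x_0-\frac{x_0}{2}(\cosh\kappa t-1)$ with width $\sigma_t$, $$\sigma_t^2=\sigma_0^2\cosh^2(\kappa t)+\Big(\frac{\hbar}{2m\sigma_0\kappa}\Big)^2\sinh^2(\kappa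 t),$$ and for every $\ell_g>0$ $$C_2^g(|\psi_t\rangle\langle\psi_t|)=1-\frac{1}{\sqrt{1+4\sigma_t^2/\ell_g^2}},$$ which is strictly increasing in $t\ge0$. -/

import Mathlib

open MeasureTheory Filter Topology Set
open scoped ENNReal NNReal ComplexConjugate SchwartzMap InnerProductSpace

noncomputable section

section HilbertSchmidt

variable {H : Type*} [NormedAddCommGroup H] [InnerProductSpace ℂ H] [CompleteSpace H]

/-- The squared Hilbert–Schmidt norm `‖A‖₂² = ∑ᵢ ‖A bᵢ‖²`, as an extended nonnegative number, for a
Hilbert basis `b` chosen once and for all; see `hsNormSq_eq` for independence of the basis. -/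
def hsNormSq (A : H →L[ℂ] H) : ℝ≥0∞ :=
  ∑' i, ‖A ((exists_hilbertBasis ℂ H).choose_spec.choose i)‖ₑ ^ 2

theorem HilbertBasis.enorm_sq_eq_tsum {ι : Type*} (b : HilbertBasis ι ℂ H) (x : H) :
    ‖x‖ₑ ^ 2 = ∑' i, ‖⟪b i, x⟫_ℂ‖ₑ ^ 2 := by
  have h := b.hasSum_inner_mul_inner x x
  have h2 : HasSum (fun i => ‖⟪b i, x⟫_ℂ‖ ^ 2) (‖x‖ ^ 2) := by
    have h3 := Complex.hasSum_re h
    rw [inner_self_eq_norm_sq_to_K] at h3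
    convert h3 using 1
    · funext i
      rw [← inner_conj_symm x (b i), ← Complex.normSq_eq_conj_mul_self, Complex.ofReal_re,
        Complex.normSq_eq_norm_sq]
    · norm_cast
  have h4 := ENNReal.ofReal_tsum_of_nonneg (fun i => sq_nonneg (‖⟪b i, x⟫_ℂ‖)) h2.summable
  rw [h2.tsum_eq, ENNReal.ofReal_pow (norm_nonneg _), ofReal_norm] at h4
  rw [h4]
  congr 1
  funext i
  rw [ENNReal.ofReal_pow (norm_nonneg _), ofReal_norm]

theorem tsum_enorm_sq_eq_adjoint {ι κ : Type*} (b : HilbertBasis ι ℂ H) (c : HilbertBasis κ ℂ H)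
    (A : H →L[ℂ] H) :
    ∑' i, ‖A (b i)‖ₑ ^ 2 = ∑' k, ‖ContinuousLinearMap.adjoint A (c k)‖ₑ ^ 2 := by
  simp_rw [c.enorm_sq_eq_tsum (A _), b.enorm_sq_eq_tsum (ContinuousLinearMap.adjoint A _)]
  rw [ENNReal.tsum_comm]
  congr! 4 with k i
  rw [ContinuousLinearMap.adjoint_inner_right, ← ofReal_norm, ← ofReal_norm, norm_inner_symm]

/-- The Hilbert–Schmidt norm may be computed in any Hilbert basis. -/
theorem hsNormSq_eq {ι : Type*} (b : HilbertBasis ι ℂ H) (A : H →L[ℂ] H) :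
    hsNormSq A = ∑' i, ‖A (b i)‖ₑ ^ 2 := by
  rw [hsNormSq, tsum_enorm_sq_eq_adjoint _ b, ← tsum_enorm_sq_eq_adjoint b b]

/-- The pure state `|ψ⟩⟨ψ|`. -/
def pureState (ψ : H) : H →L[ℂ] H := InnerProductSpace.rankOne ℂ ψ ψ

/-- The `l₂` dephasing loss `‖ρ‖₂² - ‖Δ ρ‖₂²` of the state `ρ` under the map `Δ`. -/
def l2DephasingLoss (Δ : (H →L[ℂ] H) → (H →L[ℂ] H)) (ρ : H →L[ℂ] H) : ℝ :=
  (hsNormSq ρ).toReal - (hsNormSq (Δ ρ)).toReal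

end HilbertSchmidt

/-- The Hilbert space `L²(ℝ, ℂ)` of a particle on the line. -/
abbrev LineHilbert : Type := Lp ℂ 2 (volume : Measure ℝ)

/-- The function `x ↦ exp(i p x / ħ)`. -/
def kickPhase (hbar p : ℝ) (x : ℝ) : ℂ := Complex.exp (Complex.I * (p / hbar * x : ℝ))

theorem memLp_kickPhase (hbar p : ℝ) : MemLp (kickPhase hbar p) ∞ (volume : Measure ℝ) := by
  refine memLp_top_of_bound (C := 1) ?_ (ae_of_all _ fun x => ?_)
  · exact (by unfold kickPhase; fun_prop : Continuous (kickPhase hbar p)).aestronglyMeasurable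
  · rw [kickPhase, mul_comm, Complex.norm_exp_ofReal_mul_I]

/-- The momentum kick `exp(i p X / ħ)`: multiplication by `exp(i p x / ħ)` on `L²(ℝ)`. -/
def momentumKick (hbar p : ℝ) : LineHilbert →L[ℂ] LineHilbert :=
  (ContinuousLinearMap.mul ℂ ℂ).holderL volume ∞ 2 2 ((memLp_kickPhase hbar p).toLp)

theorem momentumKick_coe (hbar p : ℝ) (φ : LineHilbert) :
    momentumKick hbar p φ =ᵐ[volume] fun x => kickPhase hbar p x * φ x := by
  rw [momentumKick, ContinuousLinearMap.holderL_apply_apply]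
  filter_upwards [(ContinuousLinearMap.mul ℂ ℂ).coeFn_holder (r := 2)
    ((memLp_kickPhase hbar p).toLp) φ, (memLp_kickPhase hbar p).coeFn_toLp] with x h1 h2
  rw [h1, h2, ContinuousLinearMap.mul_apply']

/-- The random momentum kick channel `ρ ↦ ∫ w(p) exp(ipX/ħ) ρ exp(-ipX/ħ) dp` with kick density `w`
(a Bochner integral in operator norm; the integrand is norm continuous for compact `ρ`, in
particular for every state). -/
def randomKickChannel (hbar : ℝ) (w : ℝ → ℝ) (ρ : LineHilbert →L[ℂ] LineHilbert) :
    LineHilbert →L[ℂ] LineHilbert :=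
  ∫ p : ℝ, (w p : ℂ) •
    (momentumKick hbar p ∘L ρ ∘L ContinuousLinearMap.adjoint (momentumKick hbar p))

/-- Centred Gaussian density with standard deviation `η`. -/
def gaussianKickDensity (η : ℝ) (p : ℝ) : ℝ :=
  1 / (√(2 * Real.pi) * η) * Real.exp (-p ^ 2 / (2 * η ^ 2))

/-- The Gaussian dephasing kernel `g(ξ) = exp(-ξ² / (2 ℓ²))` with coherence length `ℓ`. -/
def gaussianKernel (ℓ : ℝ) (ξ : ℝ) : ℝ := Real.exp (-ξ ^ 2 / (2 * ℓ ^ 2))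

/-- The Gaussian dephasing channel with coherence length `ℓ`: random momentum kicks with Gaussian
density of momentum spread `η = ħ / ℓ`. -/
def gaussianDephasing (hbar ℓ : ℝ) :
    (LineHilbert →L[ℂ] LineHilbert) → (LineHilbert →L[ℂ] LineHilbert) :=
  randomKickChannel hbar (gaussianKickDensity (hbar / ℓ))

/-- The Gaussian wavefunction of width `σ` centred at `c`, with phase
`α (x - c)² + β (x - c) + γ`. -/
def gaussianWave (σ c α β γ : ℝ) (x : ℝ) : ℂ :=
  ((1 / (2 * Real.pi * σ ^ 2) ^ (1 / 4 : ℝ) * Real.exp (-(x - c) ^ 2 / (4 * σ ^ 2)) : ℝ) : ℂ) *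
    Complex.exp (Complex.I * (α * (x - c) ^ 2 + β * (x - c) + γ : ℝ))

theorem memLp_gaussianWave (σ c α β γ : ℝ) :
    MemLp (gaussianWave σ c α β γ) 2 (volume : Measure ℝ) := by
  have hc : Continuous (gaussianWave σ c α β γ) := by unfold gaussianWave; fun_prop
  rw [memLp_two_iff_integrable_sq_norm hc.aestronglyMeasurable]
  rcases eq_or_ne σ 0 with rfl | hσ
  · simp [gaussianWave]
  have h := ((integrable_exp_neg_mul_sq (b := 1 / (2 * σ ^ 2)) (by positivity)).comp_sub_right
    c).const_mul ((1 / (2 * Real.pi * σ ^ 2) ^ (1 / 4 : ℝ)) ^ 2)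
  refine h.congr (ae_of_all _ fun x => ?_)
  simp only [gaussianWave]
  rw [norm_mul, mul_comm Complex.I, Complex.norm_exp_ofReal_mul_I, mul_one, Complex.norm_real,
    Real.norm_eq_abs, sq_abs, mul_pow, ← Real.exp_nat_mul]
  congr 2
  push_cast
  field_simp
  ring

/-- The Gaussian wavepacket as a vector of `L²(ℝ)`. -/
def gaussianPacket (σ c α β γ : ℝ) : LineHilbert := (memLp_gaussianWave σ c α β γ).toLp

/-- The Hamiltonian `-(ħ²/2m) d²/dx² + V(x)` acting on Schwartz functions. -/
def hamiltonian (hbar m : ℝ) (V : ℝ → ℝ) (φ : 𝓢(ℝ, ℂ)) (x : ℝ) : ℂ :=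
  -(hbar ^ 2 / (2 * m) : ℝ) * deriv (deriv φ) x + (V x : ℂ) * φ x

/-- `ψ` is a trajectory of normalized states that solves the Schrödinger equation
`iħ ∂ₜψ = -(ħ²/2m) ∂ₓ²ψ + Vψ` weakly, that is, tested against Schwartz functions in space. -/
structure IsSchrodingerEvolution (hbar m : ℝ) (V : ℝ → ℝ) (ψ : ℝ → LineHilbert) : Prop where
  norm_eq_one : ∀ t, ‖ψ t‖ = 1
  hasDerivAt : ∀ (φ : 𝓢(ℝ, ℂ)) (t : ℝ),
    HasDerivAt (fun s => ∫ x, conj (φ x) * ψ s x)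
      (-(Complex.I / hbar) * ∫ x, conj (hamiltonian hbar m V φ x) * ψ t x) t

/-- The Newtonian potential energy `-G m M / x`. -/
def newtonPotential (G m M : ℝ) (x : ℝ) : ℝ := -(G * m * M / x)

/-- Second order Taylor polynomial of `V` at `x₀`. -/
def quadraticApprox (V : ℝ → ℝ) (x₀ x : ℝ) : ℝ :=
  V x₀ + deriv V x₀ * (x - x₀) + 1 / 2 * deriv (deriv V) x₀ * (x - x₀) ^ 2

/-- The rate `κ = √(2GM/x₀³)`. -/
def newtonRate (G M x₀ : ℝ) : ℝ := √(2 * G * M / x₀ ^ 3)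

/-- The width `σₜ` of the packet, with
`σₜ² = σ₀² cosh²(κt) + (ħ/(2mσ₀κ))² sinh²(κt)`. -/
def newtonWidth (hbar G m M x₀ σ₀ t : ℝ) : ℝ :=
  √(σ₀ ^ 2 * Real.cosh (newtonRate G M x₀ * t) ^ 2 +
    (hbar / (2 * m * σ₀ * newtonRate G M x₀)) ^ 2 * Real.sinh (newtonRate G M x₀ * t) ^ 2)

/-- The classical trajectory in the quadratic potential that starts at rest at `x₀`, that is, the
solution of `q'' = -GM/x₀² + κ² (q - x₀)`; it equals `x₀ - GM/(2x₀²) t² + O(t⁴)`. -/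
def newtonCenter (G M x₀ t : ℝ) : ℝ := x₀ - x₀ / 2 * (Real.cosh (newtonRate G M x₀ * t) - 1)

end

/-!
Conjugation by the kick `exp(ipX/ħ)` multiplies a position kernel by `exp(ip(x - y)/ħ)`, so
averaging over Gaussian kicks multiplies it by the Fourier transform `g(x - y)` of the kick
density. The squared Hilbert–Schmidt norm is the squared `L²` norm of the kernel. For a packet
of width `σ` the density `|ψ|²` is that of `N(c, σ²)`, hence `‖Δ ρ‖₂²` is the expectation of
`exp(-ξ²/ℓ²)` where `ξ` is the difference of two independent such variables, that is, `ξ` has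
law `N(0, 2σ²)`.

The quadratic approximation of the Newtonian potential at `x₀` is an inverted oscillator centred
at `3x₀/2`. In a quadratic potential the exponent `a (x - c)² + b (x - c) + d` of a Gaussian
solution obeys a Riccati system, which `a = (im/2ħ) u'/u` linearizes to the classical equation
of motion for a complex `u`. The Wronskian of `u` and `ū` is constant, so that
`Re a = -1/(4σ₀²|u|²)`: the packet has width `σ₀|u|`, and its centre moves like `Re u`.

Uniqueness is a duality argument. The inner product of a weak solution with a Gaussian solution
is constant in time. At any time `T` the latter may be prescribed as
`exp(a (x - c)² + iξ (x - c))` with `ξ` arbitrary, so if two weak solutions agree at time `0`,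
then the Fourier transform of their difference at time `T`, multiplied by a Gaussian, vanishes.
-/

noncomputable section

section LTwo

variable {α E : Type*} [MeasurableSpace α] {μ : Measure α} [NormedAddCommGroup E]

theorem enorm_toLp_two_sq {f : α → E} (hf : MemLp f 2 μ) :
    ‖hf.toLp‖ₑ ^ 2 = ∫⁻ x, ‖f x‖ₑ ^ 2 ∂μ := by
  rw [Lp.enorm_toLp, eLpNorm_eq_lintegral_rpow_enorm_toReal (by norm_num) (by norm_num),
    ← ENNReal.rpow_natCast, ← ENNReal.rpow_mul]
  simp

theorem inner_toLp_left {f : α → ℂ} (hf : MemLp f 2 μ) (φ : Lp ℂ 2 μ) :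
    ⟪hf.toLp, φ⟫_ℂ = ∫ x, conj (f x) * φ x ∂μ := by
  rw [L2.inner_def]
  refine integral_congr_ae ?_
  filter_upwards [hf.coeFn_toLp] with x hx
  rw [hx, RCLike.inner_apply, mul_comm]

theorem integrable_conj_mul (f g : Lp ℂ 2 μ) : Integrable (fun x => conj (f x) * g x) μ := by
  refine (L2.integrable_inner (𝕜 := ℂ) f g).congr (.of_forall fun x => ?_)
  simp only [RCLike.inner_apply, mul_comm]

theorem tendsto_eLpNorm_zero_of_dominated {ι : Type*} {l : Filter ι} [l.IsCountablyGenerated]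
    {p : ℝ≥0∞} (hp : p ≠ ∞) {F : ι → α → E} (hF : ∀ i, MemLp (F i) p μ)
    {bound : α → ℝ} (hbound : MemLp bound p μ) (hle : ∀ᶠ i in l, ∀ᵐ x ∂μ, ‖F i x‖ ≤ bound x)
    (hlim : ∀ᵐ x ∂μ, Tendsto (fun i => F i x) l (𝓝 0)) :
    Tendsto (fun i => eLpNorm (F i) p μ) l (𝓝 0) := by
  rcases eq_or_ne p 0 with rfl | hp0
  · simpa using tendsto_const_nhds
  have hpos : 0 < p.toReal := ENNReal.toReal_pos hp0 hp
  have hpow : Tendsto (fun i => ∫ x, ‖F i x‖ ^ p.toReal ∂μ) l (𝓝 (∫ _, 0 ∂μ)) := by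
    refine tendsto_integral_filter_of_dominated_convergence (fun x => ‖bound x‖ ^ p.toReal)
      (.of_forall fun i => ((hF i).integrable_norm_rpow hp0 hp).1) ?_
      (hbound.integrable_norm_rpow hp0 hp) ?_
    · filter_upwards [hle] with i hi
      filter_upwards [hi] with x hx
      rw [Real.norm_eq_abs, Real.abs_rpow_of_nonneg (norm_nonneg _), abs_norm]
      gcongr
      exact hx.trans (le_abs_self _)
    · filter_upwards [hlim] with x hx
      simpa [hpos.ne'] using hx.norm.rpow_const (.inr hpos.le)
  rw [integral_zero] at hpow
  simp only [(hF _).eLpNorm_eq_integral_rpow_norm hp0 hp]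
  simpa [hpos.ne'] using ENNReal.tendsto_ofReal (hpow.rpow_const (.inr (inv_nonneg.mpr hpos.le)))

theorem hasDerivAt_toLp_of_dominated [NormedSpace ℝ E] {p : ℝ≥0∞} [Fact (1 ≤ p)] (hp : p ≠ ∞)
    {f : ℝ → α → E} {f' : ℝ → α → E} (hf : ∀ t, MemLp (f t) p μ) {t : ℝ} (hf' : MemLp (f' t) p μ)
    {bound : α → ℝ} (hbound : MemLp bound p μ) {s : Set ℝ} (hs : s ∈ 𝓝 t) (hconv : Convex ℝ s)
    (hderiv : ∀ r ∈ s, ∀ x, HasDerivAt (fun r => f r x) (f' r x) r)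
    (hle : ∀ r ∈ s, ∀ x, ‖f' r x‖ ≤ bound x) :
    HasDerivAt (fun r => (hf r).toLp) hf'.toLp t := by
  have ht : t ∈ s := mem_of_mem_nhds hs
  rw [hasDerivAt_iff_tendsto_slope_zero, ← tendsto_sub_nhds_zero_iff]
  have hF (h : ℝ) : MemLp (fun x => h⁻¹ • (f (t + h) x - f t x) - f' t x) p μ :=
    (((hf (t + h)).sub (hf t)).const_smul h⁻¹).sub hf'
  have heq (h : ℝ) : h⁻¹ • ((hf (t + h)).toLp - (hf t).toLp) - hf'.toLp = (hF h).toLp := by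
    rw [← MemLp.toLp_sub, ← MemLp.toLp_const_smul, ← MemLp.toLp_sub]
    rfl
  have hmem : ∀ᶠ h : ℝ in 𝓝[≠] 0, t + h ∈ s := by
    refine nhdsWithin_le_nhds ((continuous_const_add t).continuousAt.preimage_mem_nhds ?_)
    rwa [add_zero]
  simp only [heq, tendsto_zero_iff_enorm_tendsto_zero, Lp.enorm_toLp]
  refine tendsto_eLpNorm_zero_of_dominated hp hF (hbound.const_mul 2) ?_
    (.of_forall fun x => ?_)
  · filter_upwards [self_mem_nhdsWithin, hmem] with h hne hh
    refine .of_forall fun x => ?_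
    have hslope : ‖f (t + h) x - f t x‖ ≤ bound x * ‖t + h - t‖ :=
      hconv.norm_image_sub_le_of_norm_hasDerivWithin_le
        (fun r hr => (hderiv r hr x).hasDerivWithinAt) (fun r hr => hle r hr x) ht hh
    rw [add_sub_cancel_left, mul_comm, ← inv_mul_le_iff₀ (norm_pos_iff.mpr hne), ← norm_inv,
      ← norm_smul] at hslope
    calc
      _ ≤ ‖h⁻¹ • (f (t + h) x - f t x)‖ + ‖f' t x‖ := norm_sub_le _ _
      _ ≤ 2 * bound x := by linarith [hle t ht x]
  · have h := (hasDerivAt_iff_tendsto_slope_zero.mp (hderiv t ht x)).sub_const (f' t x)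
    rwa [sub_self] at h

end LTwo

section HilbertSchmidtNorm

theorem countable_of_orthonormal {𝕜 H ι : Type*} [RCLike 𝕜] [NormedAddCommGroup H]
    [InnerProductSpace 𝕜 H] [TopologicalSpace.SeparableSpace H] {v : ι → H}
    (hv : Orthonormal 𝕜 v) : Countable ι := by
  rw [← countable_univ_iff]
  refine PairwiseDisjoint.countable_of_isOpen (s := fun i => Metric.ball (v i) (1 / 2)) ?_
    (fun i _ => Metric.isOpen_ball) (fun i _ => ⟨v i, Metric.mem_ball_self (by norm_num)⟩)
  intro i _ j _ hij
  refine Metric.ball_disjoint_ball ?_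
  have hdist : ‖v i - v j‖ ^ 2 = 2 := by
    rw [@norm_sub_sq 𝕜, hv.1 i, hv.1 j, hv.2 hij]
    norm_num
  rw [dist_eq_norm]
  nlinarith [norm_nonneg (v i - v j)]

/- Expand `A` in a Hilbert basis `b`: for fixed `x`, Parseval's identity for the conjugate of `k x`
evaluates `∑ᵢ |(A bᵢ)(x)|²`. -/
theorem hsNormSq_eq_lintegral_kernel {α : Type*} [MeasurableSpace α] {μ : Measure α}
    [TopologicalSpace.SeparableSpace (Lp ℂ 2 μ)] {A : Lp ℂ 2 μ →L[ℂ] Lp ℂ 2 μ} {k : α → α → ℂ}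
    (hk : ∀ x, MemLp (k x) 2 μ) (hA : ∀ φ : Lp ℂ 2 μ, A φ =ᵐ[μ] fun x => ∫ y, k x y * φ y ∂μ) :
    hsNormSq A = ∫⁻ x, ∫⁻ y, ‖k x y‖ₑ ^ 2 ∂μ ∂μ := by
  obtain ⟨s, b, -⟩ := exists_hilbertBasis ℂ (Lp ℂ 2 μ)
  have : Countable s := countable_of_orthonormal b.orthonormal
  have hk' (x : α) : MemLp (fun y => conj (k x y)) 2 μ := (hk x).star
  have hcoeff (i : s) : (fun x => ‖A (b i) x‖ₑ ^ 2) =ᵐ[μ]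
      fun x => ‖⟪b i, (hk' x).toLp⟫_ℂ‖ₑ ^ 2 := by
    filter_upwards [hA (b i)] with x hx
    rw [hx, ← ofReal_norm, ← ofReal_norm, norm_inner_symm, inner_toLp_left]
    simp only [Complex.conj_conj]
  calc
    hsNormSq A = ∑' i, ∫⁻ x, ‖A (b i) x‖ₑ ^ 2 ∂μ := by
      simp only [hsNormSq_eq b, ← enorm_toLp_two_sq (Lp.memLp (A (b _))), Lp.toLp_coeFn]
    _ = ∫⁻ x, ∑' i, ‖A (b i) x‖ₑ ^ 2 ∂μ := by
      rw [lintegral_tsum fun i => ((Lp.aestronglyMeasurable (A (b i))).enorm.pow_const 2)]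
    _ = ∫⁻ x, ∑' i, ‖⟪b i, (hk' x).toLp⟫_ℂ‖ₑ ^ 2 ∂μ := by
      refine lintegral_congr_ae ?_
      filter_upwards [ae_all_iff.mpr hcoeff] with x hx
      simp only [hx]
    _ = ∫⁻ x, ∫⁻ y, ‖k x y‖ₑ ^ 2 ∂μ ∂μ := by
      simp only [← b.enorm_sq_eq_tsum, enorm_toLp_two_sq, RCLike.enorm_conj]

theorem hsNormSq_pureState {H : Type*} [NormedAddCommGroup H] [InnerProductSpace ℂ H]
    [CompleteSpace H] (ψ : H) : hsNormSq (pureState ψ) = ‖ψ‖ₑ ^ 4 := by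
  obtain ⟨s, b, -⟩ := exists_hilbertBasis ℂ H
  have hcoeff (i : s) : ‖pureState ψ (b i)‖ₑ ^ 2 = ‖⟪b i, ψ⟫_ℂ‖ₑ ^ 2 * ‖ψ‖ₑ ^ 2 := by
    rw [pureState, InnerProductSpace.rankOne_apply, enorm_smul, mul_pow, ← ofReal_norm,
      norm_inner_symm, ofReal_norm]
  simp only [hsNormSq_eq b, hcoeff]
  rw [ENNReal.tsum_mul_right, ← b.enorm_sq_eq_tsum]
  ring

end HilbertSchmidtNorm

section MomentumKicks

variable (hbar : ℝ)

theorem continuous_kickPhase : Continuous fun q : ℝ × ℝ => kickPhase hbar q.1 q.2 := by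
  unfold kickPhase
  fun_prop

theorem norm_kickPhase (p x : ℝ) : ‖kickPhase hbar p x‖ = 1 := by
  rw [kickPhase, mul_comm, Complex.norm_exp_ofReal_mul_I]

theorem kickPhase_sub (p x y : ℝ) :
    kickPhase hbar p (x - y) = kickPhase hbar p x * conj (kickPhase hbar p y) := by
  rw [kickPhase, kickPhase, kickPhase, ← Complex.exp_conj, ← Complex.exp_add, map_mul,
    Complex.conj_I, Complex.conj_ofReal]
  congr 1
  push_cast
  ring

theorem norm_momentumKick (p : ℝ) (φ : LineHilbert) : ‖momentumKick hbar p φ‖ = ‖φ‖ := by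
  rw [Lp.norm_def, Lp.norm_def]
  congr 1
  refine eLpNorm_congr_norm_ae ?_
  filter_upwards [momentumKick_coe hbar p φ] with x hx
  rw [hx, norm_mul, norm_kickPhase, one_mul]

theorem continuous_momentumKick (φ : LineHilbert) : Continuous fun p => momentumKick hbar p φ := by
  refine continuous_iff_continuousAt.mpr fun p₀ => tendsto_sub_nhds_zero_iff.mp ?_
  have hcoe (p : ℝ) : ⇑(momentumKick hbar p φ - momentumKick hbar p₀ φ) =ᵐ[volume]
      fun x => (kickPhase hbar p x - kickPhase hbar p₀ x) * φ x := by
    filter_upwards [Lp.coeFn_sub (momentumKick hbar p φ) (momentumKick hbar p₀ φ),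
      momentumKick_coe hbar p φ, momentumKick_coe hbar p₀ φ] with x h h₁ h₂
    rw [h, Pi.sub_apply, h₁, h₂, sub_mul]
  simp only [tendsto_zero_iff_enorm_tendsto_zero, Lp.enorm_def, eLpNorm_congr_ae (hcoe _)]
  refine tendsto_eLpNorm_zero_of_dominated (by norm_num)
    (fun p => (memLp_congr_ae (hcoe p)).mp (Lp.memLp _)) ((Lp.memLp φ).norm.const_mul 2)
    (.of_forall fun p => .of_forall fun x => ?_) (.of_forall fun x => ?_)
  · rw [norm_mul]
    gcongr
    calc
      _ ≤ ‖kickPhase hbar p x‖ + ‖kickPhase hbar p₀ x‖ := norm_sub_le _ _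
      _ = 2 := by rw [norm_kickPhase, norm_kickPhase]; norm_num
  · have hc : Continuous fun p => (kickPhase hbar p x - kickPhase hbar p₀ x) * φ x := by
      unfold kickPhase
      fun_prop
    simpa using hc.tendsto p₀

theorem inner_momentumKick_right (p : ℝ) (f ψ : LineHilbert) :
    ⟪f, momentumKick hbar p ψ⟫_ℂ = ∫ x, kickPhase hbar p x * (conj (f x) * ψ x) := by
  rw [L2.inner_def]
  refine integral_congr_ae ?_
  filter_upwards [momentumKick_coe hbar p ψ] with x hx
  rw [hx, RCLike.inner_apply]
  ring

theorem inner_momentumKick_left (p : ℝ) (ψ φ : LineHilbert) :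
    ⟪momentumKick hbar p ψ, φ⟫_ℂ = ∫ y, conj (kickPhase hbar p y) * (conj (ψ y) * φ y) := by
  rw [L2.inner_def]
  refine integral_congr_ae ?_
  filter_upwards [momentumKick_coe hbar p ψ] with y hy
  rw [hy, RCLike.inner_apply, map_mul]
  ring

theorem momentumKick_comp_pureState_comp_adjoint (p : ℝ) (ψ : LineHilbert) :
    momentumKick hbar p ∘L pureState ψ ∘L ContinuousLinearMap.adjoint (momentumKick hbar p) =
      pureState (momentumKick hbar p ψ) := by
  rw [pureState, InnerProductSpace.rankOne_comp, InnerProductSpace.comp_rankOne,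
    ContinuousLinearMap.adjoint_adjoint, pureState]

theorem integrable_smul_momentumKick {w : ℝ → ℂ} (hw : Integrable w) (ψ : LineHilbert) :
    Integrable fun p => w p • momentumKick hbar p ψ := by
  refine (hw.norm.mul_const ‖ψ‖).mono'
    (hw.1.smul (continuous_momentumKick hbar ψ).aestronglyMeasurable) (.of_forall fun p => ?_)
  rw [norm_smul, norm_momentumKick]

theorem integrable_mul_inner_momentumKick {w : ℝ → ℂ} (hw : Integrable w) (ψ φ : LineHilbert) :
    Integrable fun p => w p * ⟪momentumKick hbar p ψ, φ⟫_ℂ := by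
  have hc := (continuous_momentumKick hbar ψ).inner (𝕜 := ℂ) (continuous_const (y := φ))
  refine (hw.norm.mul_const (‖ψ‖ * ‖φ‖)).mono' (hw.1.mul hc.aestronglyMeasurable)
    (.of_forall fun p => ?_)
  rw [norm_mul]
  gcongr
  exact (norm_inner_le_norm _ _).trans_eq (by rw [norm_momentumKick])

theorem randomKickChannel_pureState_apply {w : ℝ → ℝ} (hw : Integrable w) (ψ φ : LineHilbert) :
    randomKickChannel hbar w (pureState ψ) φ =
      ∫ p : ℝ, ((w p : ℂ) * ⟪momentumKick hbar p ψ, φ⟫_ℂ) • momentumKick hbar p ψ := by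
  have hcont : Continuous fun p => pureState (momentumKick hbar p ψ) := by
    have hψ := continuous_momentumKick hbar ψ
    exact ((ContinuousLinearMap.smulRightL ℂ LineHilbert LineHilbert).continuous.comp
      ((innerSL ℂ).continuous.comp hψ)).clm_apply hψ
  have hint : Integrable fun p : ℝ => (w p : ℂ) • pureState (momentumKick hbar p ψ) := by
    refine (hw.norm.mul_const (‖ψ‖ * ‖ψ‖)).mono'
      (hw.ofReal.aestronglyMeasurable.fun_smul hcont.aestronglyMeasurable)
      (.of_forall fun p => ?_)
    rw [norm_smul, pureState, InnerProductSpace.norm_rankOne, norm_momentumKick, Complex.norm_real]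
  simp only [randomKickChannel, momentumKick_comp_pureState_comp_adjoint]
  rw [ContinuousLinearMap.integral_apply hint]
  simp only [pureState, _root_.smul_apply, InnerProductSpace.rankOne_apply, smul_smul]

end MomentumKicks

section KickTransform

theorem integral_mul_integral_mul_eq {α β : Type*} [MeasurableSpace α] [MeasurableSpace β]
    {μ : Measure α} {ν : Measure β} [SFinite μ] [SFinite ν] {f : α → ℂ} {g : β → ℂ}
    {k : α → β → ℂ} {C : ℝ} (hf : Integrable f μ) (hg : Integrable g ν)
    (hk : AEStronglyMeasurable (fun q : α × β => k q.1 q.2) (μ.prod ν))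
    (hC : ∀ a b, ‖k a b‖ ≤ C) :
    ∫ a, f a * ∫ b, k a b * g b ∂ν ∂μ = ∫ b, (∫ a, f a * k a b ∂μ) * g b ∂ν := by
  have hint := (hf.mul_prod hg).bdd_mul hk (.of_forall fun q => hC q.1 q.2)
  simp only [← integral_const_mul, ← integral_mul_const]
  rw [← integral_integral_swap (f := fun a b => f a * k a b * g b)]
  · simp only [mul_assoc]
  · exact hint.congr (.of_forall fun q => by simp only [Function.uncurry]; ring)

/-- The Fourier transform of `w` in the normalization of the kicks `exp(ipX/ħ)`. In position
representation, random momentum kicks with density `w` multiply kernels by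
`kickTransform hbar w (x - y)`. -/
def kickTransform (hbar : ℝ) (w : ℝ → ℂ) (x : ℝ) : ℂ := ∫ p, w p * kickPhase hbar p x

variable (hbar : ℝ) {w : ℝ → ℂ}

theorem continuous_kickTransform (hw : Integrable w) : Continuous (kickTransform hbar w) := by
  have hc := continuous_kickPhase hbar
  refine continuous_of_dominated (bound := fun p => ‖w p‖) (fun x => ?_)
    (fun x => .of_forall fun p => ?_) hw.norm (.of_forall fun p => ?_)
  · exact hw.1.fun_mul (Continuous.aestronglyMeasurable (by fun_prop))
  · rw [norm_mul, norm_kickPhase, mul_one]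
  · fun_prop

theorem norm_kickTransform_le (hw : Integrable w) (x : ℝ) :
    ‖kickTransform hbar w x‖ ≤ ∫ p, ‖w p‖ := by
  refine norm_integral_le_of_norm_le hw.norm (.of_forall fun p => ?_)
  rw [norm_mul, norm_kickPhase, mul_one]

theorem memLp_kickTransform_mul (hw : Integrable w) (ψ : LineHilbert) :
    MemLp (fun x => kickTransform hbar w x * ψ x) 2 volume := by
  refine .of_le_mul (c := ∫ p, ‖w p‖) (Lp.memLp ψ)
    ((continuous_kickTransform hbar hw).aestronglyMeasurable.mul (Lp.aestronglyMeasurable ψ))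
    (.of_forall fun x => ?_)
  rw [norm_mul]
  gcongr
  exact norm_kickTransform_le hbar hw x

theorem integral_smul_momentumKick_ae_eq (hw : Integrable w) (ψ : LineHilbert) :
    ⇑(∫ p, w p • momentumKick hbar p ψ) =ᵐ[volume] fun x => kickTransform hbar w x * ψ x := by
  have hmem := memLp_kickTransform_mul hbar hw ψ
  suffices h : ∫ p, w p • momentumKick hbar p ψ = hmem.toLp by
    rw [h]
    exact hmem.coeFn_toLp
  refine ext_inner_left ℂ fun f => ?_
  calc
    _ = ∫ p, w p * ∫ x, kickPhase hbar p x * (conj (f x) * ψ x) := by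
      rw [← integral_inner (integrable_smul_momentumKick hbar hw ψ)]
      simp only [inner_smul_right, inner_momentumKick_right]
    _ = ∫ x, kickTransform hbar w x * (conj (f x) * ψ x) :=
      integral_mul_integral_mul_eq hw (integrable_conj_mul f ψ)
        (continuous_kickPhase hbar).aestronglyMeasurable fun p x => (norm_kickPhase hbar p x).le
    _ = _ := by
      rw [L2.inner_def]
      refine integral_congr_ae ?_
      filter_upwards [hmem.coeFn_toLp] with x hx
      rw [hx, RCLike.inner_apply]
      ring

theorem kickTransform_mul_inner_momentumKick (hw : Integrable w) (ψ φ : LineHilbert) (x : ℝ) :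
    kickTransform hbar (fun p => w p * ⟪momentumKick hbar p ψ, φ⟫_ℂ) x =
      ∫ y, kickTransform hbar w (x - y) * (conj (ψ y) * φ y) := by
  have hwx : Integrable fun p => w p * kickPhase hbar p x := by
    have hc := continuous_kickPhase hbar
    refine hw.mul_bdd (c := 1) (Continuous.aestronglyMeasurable (by fun_prop))
      (.of_forall fun p => ?_)
    rw [norm_kickPhase]
  have hc : Continuous fun q : ℝ × ℝ => conj (kickPhase hbar q.1 q.2) :=
    Complex.continuous_conj.comp (continuous_kickPhase hbar)
  calc
    _ = ∫ p, w p * kickPhase hbar p x *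
        ∫ y, conj (kickPhase hbar p y) * (conj (ψ y) * φ y) := by
      simp only [kickTransform, inner_momentumKick_left, mul_right_comm]
    _ = ∫ y, (∫ p, w p * kickPhase hbar p x * conj (kickPhase hbar p y)) *
        (conj (ψ y) * φ y) :=
      integral_mul_integral_mul_eq hwx (integrable_conj_mul ψ φ) hc.aestronglyMeasurable
        fun p y => (RCLike.norm_conj _).trans_le (norm_kickPhase hbar p y).le
    _ = _ := by simp only [kickTransform, kickPhase_sub, mul_assoc]

theorem randomKickChannel_pureState_apply_ae_eq {w : ℝ → ℝ} (hw : Integrable w)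
    (ψ φ : LineHilbert) :
    randomKickChannel hbar w (pureState ψ) φ =ᵐ[volume] fun x =>
      ∫ y, kickTransform hbar (fun p => (w p : ℂ)) (x - y) * (ψ x * conj (ψ y)) * φ y := by
  have hw' : Integrable fun p => (w p : ℂ) := hw.ofReal
  have hint := integrable_mul_inner_momentumKick hbar hw' ψ φ
  rw [randomKickChannel_pureState_apply hbar hw]
  filter_upwards [integral_smul_momentumKick_ae_eq hbar hint ψ] with x hx
  rw [hx, kickTransform_mul_inner_momentumKick hbar hw', ← integral_mul_const]
  refine integral_congr_ae (.of_forall fun y => ?_)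
  simp only
  ring

theorem hsNormSq_randomKickChannel_pureState {w : ℝ → ℝ} (hw : Integrable w) (ψ : LineHilbert) :
    hsNormSq (randomKickChannel hbar w (pureState ψ)) =
      ∫⁻ x, ∫⁻ y, ‖kickTransform hbar (fun p => (w p : ℂ)) (x - y)‖ₑ ^ 2 *
        (‖ψ x‖ₑ ^ 2 * ‖ψ y‖ₑ ^ 2) := by
  have : Fact ((2 : ℝ≥0∞) ≠ ∞) := ⟨by norm_num⟩
  have hc := continuous_kickTransform hbar hw.ofReal
  rw [hsNormSq_eq_lintegral_kernel (fun x => ?_)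
    (randomKickChannel_pureState_apply_ae_eq hbar hw ψ)]
  · simp only [enorm_mul, mul_pow, RCLike.enorm_conj]
  · refine .of_le_mul (c := (∫ p, ‖(w p : ℂ)‖) * ‖ψ x‖) (Lp.memLp ψ) ?_ (.of_forall fun y => ?_)
    · exact (Continuous.aestronglyMeasurable (by fun_prop)).mul
        ((Lp.memLp ψ).star.aestronglyMeasurable.const_mul _)
    · rw [norm_mul, norm_mul, RCLike.norm_conj, ← mul_assoc]
      gcongr
      exact norm_kickTransform_le hbar hw.ofReal _

end KickTransform

open ProbabilityTheory in
theorem gaussianKickDensity_eq_gaussianPDFReal {η : ℝ} (hη : 0 < η) :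
    gaussianKickDensity η = gaussianPDFReal 0 (η ^ 2).toNNReal := by
  ext p
  rw [gaussianKickDensity, gaussianPDFReal, Real.coe_toNNReal _ (sq_nonneg η),
    Real.sqrt_mul (by positivity : (0 : ℝ) ≤ 2 * Real.pi), Real.sqrt_sq hη.le, sub_zero, one_div]

theorem integrable_gaussianKickDensity {η : ℝ} (hη : 0 < η) :
    Integrable (gaussianKickDensity η) := by
  rw [gaussianKickDensity_eq_gaussianPDFReal hη]
  exact ProbabilityTheory.integrable_gaussianPDFReal _ _

open ProbabilityTheory in
theorem kickTransform_gaussianKickDensity {hbar ℓ : ℝ} (hhbar : 0 < hbar) (hℓ : 0 < ℓ) (ξ : ℝ) :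
    kickTransform hbar (fun p => (gaussianKickDensity (hbar / ℓ) p : ℂ)) ξ =
      gaussianKernel ℓ ξ := by
  have hη : ((hbar / ℓ) ^ 2).toNNReal ≠ 0 := (Real.toNNReal_pos.2 (by positivity)).ne'
  have hhbar' : (hbar : ℂ) ≠ 0 := Complex.ofReal_ne_zero.2 hhbar.ne'
  have h := charFun_gaussianReal (μ := 0) (v := ((hbar / ℓ) ^ 2).toNNReal) (ξ / hbar)
  rw [charFun_apply_real, integral_gaussianReal_eq_integral_smul hη] at h
  calc kickTransform hbar (fun p => (gaussianKickDensity (hbar / ℓ) p : ℂ)) ξ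
      = ∫ p, gaussianPDFReal 0 ((hbar / ℓ) ^ 2).toNNReal p •
          Complex.exp (((ξ / hbar : ℝ) : ℂ) * p * Complex.I) := by
        refine integral_congr_ae (.of_forall fun p => ?_)
        simp only [gaussianKickDensity_eq_gaussianPDFReal (div_pos hhbar hℓ), kickPhase,
          Complex.real_smul]
        congr 2
        push_cast
        ring
    _ = gaussianKernel ℓ ξ := by
        rw [h, gaussianKernel, Complex.ofReal_exp, Real.coe_toNNReal _ (sq_nonneg _)]
        congr 1
        push_cast
        field_simp
        ring

theorem gaussianDephasing_pureState_apply_ae_eq {hbar ℓ : ℝ} (hhbar : 0 < hbar) (hℓ : 0 < ℓ)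
    (ψ φ : LineHilbert) :
    gaussianDephasing hbar ℓ (pureState ψ) φ =ᵐ[volume]
      fun x => ∫ y, (gaussianKernel ℓ (x - y) : ℂ) * (ψ x * conj (ψ y)) * φ y := by
  simpa only [gaussianDephasing, kickTransform_gaussianKickDensity hhbar hℓ] using
    randomKickChannel_pureState_apply_ae_eq hbar
      (integrable_gaussianKickDensity (div_pos hhbar hℓ)) ψ φ

theorem enorm_gaussianKernel_sq (ℓ ξ : ℝ) :
    ‖(gaussianKernel ℓ ξ : ℂ)‖ₑ ^ 2 = ENNReal.ofReal (Real.exp (-(1 / ℓ ^ 2 * ξ ^ 2))) := by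
  rw [← ofReal_norm, ← ENNReal.ofReal_pow (norm_nonneg _), Complex.norm_real, Real.norm_eq_abs,
    sq_abs, gaussianKernel, ← Real.exp_nat_mul]
  congr 2
  push_cast
  field_simp

open ProbabilityTheory in
theorem enorm_gaussianWave_sq {σ : ℝ} (hσ : 0 < σ) (c α β γ x : ℝ) :
    ‖gaussianWave σ c α β γ x‖ₑ ^ 2 = gaussianPDF c (σ ^ 2).toNNReal x := by
  rw [← ofReal_norm, ← ENNReal.ofReal_pow (norm_nonneg _), gaussianPDF, gaussianPDFReal,
    gaussianWave, norm_mul, mul_comm Complex.I, Complex.norm_exp_ofReal_mul_I, mul_one,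
    Complex.norm_real, Real.norm_eq_abs, sq_abs, mul_pow, ← Real.exp_nat_mul, div_pow, one_pow,
    one_div, ← Real.rpow_natCast, ← Real.rpow_mul (by positivity), Real.sqrt_eq_rpow,
    Real.coe_toNNReal _ (sq_nonneg σ)]
  congr 3
  · norm_num
  · push_cast
    ring

open ProbabilityTheory in
theorem lintegral_enorm_gaussianPacket_sq_mul {σ : ℝ} (hσ : 0 < σ) (c α β γ : ℝ) (f : ℝ → ℝ≥0∞) :
    ∫⁻ x, ‖gaussianPacket σ c α β γ x‖ₑ ^ 2 * f x =
      ∫⁻ x, f x ∂gaussianReal c (σ ^ 2).toNNReal := by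
  have hv : (σ ^ 2).toNNReal ≠ 0 := (Real.toNNReal_pos.2 (by positivity)).ne'
  rw [gaussianReal_of_var_ne_zero c hv, lintegral_withDensity_eq_lintegral_mul_non_measurable _
    (measurable_gaussianPDF _ _) (.of_forall fun _ => gaussianPDF_lt_top)]
  refine lintegral_congr_ae ?_
  filter_upwards [(memLp_gaussianWave σ c α β γ).coeFn_toLp] with x hx
  rw [Pi.mul_apply, ← enorm_gaussianWave_sq hσ c α β γ, gaussianPacket, hx]

theorem norm_gaussianPacket {σ : ℝ} (hσ : 0 < σ) (c α β γ : ℝ) :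
    ‖gaussianPacket σ c α β γ‖ = 1 := by
  have h : ‖gaussianPacket σ c α β γ‖ₑ ^ 2 = 1 := by
    rw [← Lp.toLp_coeFn (gaussianPacket σ c α β γ) (Lp.memLp _), enorm_toLp_two_sq]
    simpa using lintegral_enorm_gaussianPacket_sq_mul hσ c α β γ 1
  rw [← pow_eq_one_iff_of_nonneg (norm_nonneg _) two_ne_zero, ← toReal_enorm, ← ENNReal.toReal_pow,
    h, ENNReal.toReal_one]

open ProbabilityTheory in
theorem lintegral_lintegral_sub_gaussianReal (m₁ m₂ : ℝ) (v₁ v₂ : ℝ≥0) {f : ℝ → ℝ≥0∞}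
    (hf : Measurable f) :
    ∫⁻ x, ∫⁻ y, f (x - y) ∂gaussianReal m₂ v₂ ∂gaussianReal m₁ v₁ =
      ∫⁻ z, f z ∂gaussianReal (m₁ - m₂) (v₁ + v₂) := by
  rw [sub_eq_add_neg m₁, ← gaussianReal_conv_gaussianReal, Measure.lintegral_conv hf]
  refine lintegral_congr fun x => ?_
  rw [← gaussianReal_map_neg, lintegral_map (by fun_prop) measurable_neg]
  simp only [sub_eq_add_neg]

open ProbabilityTheory in
theorem lintegral_exp_neg_mul_sq_gaussianReal {a : ℝ} (ha : 0 ≤ a) (v : ℝ≥0) :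
    ∫⁻ z, ENNReal.ofReal (Real.exp (-(a * z ^ 2))) ∂gaussianReal 0 v =
      ENNReal.ofReal (1 / √(1 + 2 * a * v)) := by
  rcases eq_or_ne v 0 with rfl | hv
  · simp
  have hprod (z : ℝ) : gaussianPDFReal 0 v z • Real.exp (-(a * z ^ 2)) =
      (√(2 * Real.pi * v))⁻¹ * Real.exp (-((1 + 2 * a * v) / (2 * v)) * z ^ 2) := by
    rw [gaussianPDFReal, smul_eq_mul, mul_assoc, ← Real.exp_add]
    congr 2
    field_simp
    ring
  rw [← ofReal_integral_eq_lintegral_ofReal _ (.of_forall fun _ => Real.exp_nonneg _),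
    integral_gaussianReal_eq_integral_smul hv]
  · simp only [hprod]
    rw [integral_const_mul, integral_gaussian, ← Real.sqrt_inv, ← Real.sqrt_mul (by positivity),
      one_div, ← Real.sqrt_inv]
    congr 2
    field_simp
  · refine (integrable_const (1 : ℝ)).mono' (by fun_prop) (.of_forall fun z => ?_)
    rw [Real.norm_eq_abs, Real.abs_exp, Real.exp_le_one_iff, neg_nonpos]
    positivity

/-- The `l₂` dephasing loss of a Gaussian wavepacket as a function of the ratio `u = σ / ℓ` of its
width to the coherence length. -/
def gaussianLoss (u : ℝ) : ℝ := 1 - 1 / √(1 + 4 * u ^ 2)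

/- The two position variables of the kernel are independent with the law `N(c, σ²)` of `|ψ|²`, and
the loss only involves their difference. -/
open ProbabilityTheory in
theorem hsNormSq_gaussianDephasing_gaussianPacket {hbar ℓ σ : ℝ} (hhbar : 0 < hbar) (hℓ : 0 < ℓ)
    (hσ : 0 < σ) (c α β γ : ℝ) :
    hsNormSq (gaussianDephasing hbar ℓ (pureState (gaussianPacket σ c α β γ))) =
      ENNReal.ofReal (1 / √(1 + 4 * (σ / ℓ) ^ 2)) := by
  set ψ := gaussianPacket σ c α β γ
  set v := (σ ^ 2).toNNReal with hv
  calc hsNormSq (gaussianDephasing hbar ℓ (pureState ψ))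
      = ∫⁻ x, ∫⁻ y, ENNReal.ofReal (Real.exp (-(1 / ℓ ^ 2 * (x - y) ^ 2))) *
          (‖ψ x‖ₑ ^ 2 * ‖ψ y‖ₑ ^ 2) := by
        simpa only [gaussianDephasing, kickTransform_gaussianKickDensity hhbar hℓ,
          enorm_gaussianKernel_sq] using hsNormSq_randomKickChannel_pureState hbar
            (integrable_gaussianKickDensity (div_pos hhbar hℓ)) ψ
    _ = ∫⁻ x, ‖ψ x‖ₑ ^ 2 * ∫⁻ y, ‖ψ y‖ₑ ^ 2 *
          ENNReal.ofReal (Real.exp (-(1 / ℓ ^ 2 * (x - y) ^ 2))) := by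
        refine lintegral_congr fun x => ?_
        rw [← lintegral_const_mul' _ _ (by finiteness)]
        exact lintegral_congr fun y => by ring
    _ = ∫⁻ x, ∫⁻ y, ENNReal.ofReal (Real.exp (-(1 / ℓ ^ 2 * (x - y) ^ 2)))
          ∂gaussianReal c v ∂gaussianReal c v := by
        simp only [ψ, lintegral_enorm_gaussianPacket_sq_mul hσ, hv]
    _ = ∫⁻ z, ENNReal.ofReal (Real.exp (-(1 / ℓ ^ 2 * z ^ 2))) ∂gaussianReal 0 (v + v) := by
        rw [lintegral_lintegral_sub_gaussianReal c c v v
          (f := fun z => ENNReal.ofReal (Real.exp (-(1 / ℓ ^ 2 * z ^ 2)))) (by fun_prop), sub_self]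
    _ = ENNReal.ofReal (1 / √(1 + 4 * (σ / ℓ) ^ 2)) := by
        rw [lintegral_exp_neg_mul_sq_gaussianReal (by positivity), NNReal.coe_add, hv,
          Real.coe_toNNReal _ (sq_nonneg σ)]
        congr 4
        field_simp
        norm_num

theorem l2DephasingLoss_gaussianPacket {hbar ℓ σ : ℝ} (hhbar : 0 < hbar) (hℓ : 0 < ℓ) (hσ : 0 < σ)
    (c α β γ : ℝ) :
    l2DephasingLoss (gaussianDephasing hbar ℓ) (pureState (gaussianPacket σ c α β γ)) =
      gaussianLoss (σ / ℓ) := by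
  rw [l2DephasingLoss, hsNormSq_pureState, ← ofReal_norm, norm_gaussianPacket hσ,
    hsNormSq_gaussianDephasing_gaussianPacket hhbar hℓ hσ, ENNReal.toReal_ofReal (by positivity)]
  simp [gaussianLoss]

theorem gaussianLoss_div (σ ℓ : ℝ) :
    gaussianLoss (σ / ℓ) = 1 - 1 / √(1 + 4 * σ ^ 2 / ℓ ^ 2) := by
  rw [gaussianLoss, div_pow, mul_div_assoc]

theorem strictMonoOn_gaussianLoss : StrictMonoOn gaussianLoss (Ici 0) := by
  intro u hu w _ huw
  rw [mem_Ici] at hu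
  simp only [gaussianLoss]
  gcongr

theorem tendsto_gaussianLoss_zero : Tendsto gaussianLoss (𝓝 0) (𝓝 0) := by
  have h : ContinuousAt gaussianLoss 0 := by
    have : √(1 + 4 * (0 : ℝ) ^ 2) ≠ 0 := by norm_num
    unfold gaussianLoss
    fun_prop (disch := assumption)
  have h0 : gaussianLoss 0 = 0 := by simp [gaussianLoss]
  simpa only [h0] using h.tendsto

theorem tendsto_gaussianLoss_atTop : Tendsto gaussianLoss atTop (𝓝 1) := by
  have h : Tendsto (fun u : ℝ => 1 + 4 * u ^ 2) atTop atTop :=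
    tendsto_atTop_add_const_left _ _
      ((tendsto_pow_atTop two_ne_zero).const_mul_atTop (by norm_num))
  unfold gaussianLoss
  simpa [Function.comp_def] using ((Real.tendsto_sqrt_atTop.comp h).inv_tendsto_atTop).const_sub 1

theorem strictMonoOn_l2DephasingLoss_of_eq_gaussianPacket {ι : Type*} [Preorder ι] {hbar ℓ : ℝ}
    (hhbar : 0 < hbar) (hℓ : 0 < ℓ) {ψ : ι → LineHilbert} {σ c : ι → ℝ} {s : Set ι}
    (hψ : ∀ t, ∃ α β γ : ℝ, ψ t = gaussianPacket (σ t) (c t) α β γ) (hσ : ∀ t, 0 < σ t)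
    (hmono : StrictMonoOn σ s) :
    StrictMonoOn (fun t => l2DephasingLoss (gaussianDephasing hbar ℓ) (pureState (ψ t))) s := by
  have hloss (t : ι) : l2DephasingLoss (gaussianDephasing hbar ℓ) (pureState (ψ t)) =
      gaussianLoss (σ t / ℓ) := by
    obtain ⟨α, β, γ, hψt⟩ := hψ t
    rw [hψt, l2DephasingLoss_gaussianPacket hhbar hℓ (hσ t)]
  simp only [hloss]
  exact strictMonoOn_gaussianLoss.comp (fun _ ha _ hb hab => by gcongr; exact hmono ha hb hab)
    fun t _ => (div_pos (hσ t) hℓ).le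

theorem exists_norm_polynomial_eval_le_exp (P : Polynomial ℂ) :
    ∃ M : ℝ, ∀ x : ℝ, ‖P.eval (x : ℂ)‖ ≤ M * Real.exp |x| := by
  induction P using Polynomial.induction_on' with
  | add p q hp hq =>
    obtain ⟨M, hM⟩ := hp
    obtain ⟨N, hN⟩ := hq
    refine ⟨M + N, fun x => ?_⟩
    rw [Polynomial.eval_add, add_mul]
    exact norm_add_le_of_le (hM x) (hN x)
  | monomial n a =>
    refine ⟨‖a‖ * n.factorial, fun x => ?_⟩
    have h := Real.pow_div_factorial_le_exp |x| (abs_nonneg x) n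
    rw [div_le_iff₀ (by positivity)] at h
    rw [Polynomial.eval_monomial, norm_mul, norm_pow, Complex.norm_real, Real.norm_eq_abs,
      mul_assoc, mul_comm (n.factorial : ℝ)]
    gcongr

/-- The function `P(x) exp(Q(x))` of a real variable. These functions are closed under
differentiation, which makes them Schwartz functions as soon as `Re Q` decays quadratically. -/
def polyExp (P Q : Polynomial ℂ) (x : ℝ) : ℂ :=
  P.eval (x : ℂ) * Complex.exp (Q.eval (x : ℂ))

theorem hasDerivAt_polyExp (P Q : Polynomial ℂ) (x : ℝ) :
    HasDerivAt (polyExp P Q) (polyExp (P.derivative + P * Q.derivative) Q x) x := by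
  have hP := (P.hasDerivAt (x : ℂ)).comp_ofReal
  have hQ := (Q.hasDerivAt (x : ℂ)).comp_ofReal
  refine (hP.mul hQ.cexp).congr_deriv ?_
  simp only [polyExp, Polynomial.eval_add, Polynomial.eval_mul]
  ring

theorem deriv_polyExp (P Q : Polynomial ℂ) :
    deriv (polyExp P Q) = polyExp (P.derivative + P * Q.derivative) Q :=
  funext fun x => (hasDerivAt_polyExp P Q x).deriv

theorem exists_iteratedDeriv_polyExp (P Q : Polynomial ℂ) (n : ℕ) :
    ∃ R : Polynomial ℂ, iteratedDeriv n (polyExp P Q) = polyExp R Q := by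
  induction n with
  | zero => exact ⟨P, iteratedDeriv_zero⟩
  | succ n ih =>
    obtain ⟨R, hR⟩ := ih
    exact ⟨_, by rw [iteratedDeriv_succ, hR, deriv_polyExp]⟩

theorem contDiff_polyExp (P Q : Polynomial ℂ) : ContDiff ℝ (⊤ : ℕ∞) (polyExp P Q) := by
  refine contDiff_of_differentiable_iteratedDeriv fun n _ => ?_
  obtain ⟨R, hR⟩ := exists_iteratedDeriv_polyExp P Q n
  exact hR ▸ fun x => (hasDerivAt_polyExp R Q x).differentiableAt

theorem exists_norm_polyExp_le (P : Polynomial ℂ) {Q : Polynomial ℂ} {δ K : ℝ} (hδ : 0 < δ)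
    (hQ : ∀ x : ℝ, (Q.eval (x : ℂ)).re ≤ K - δ * x ^ 2) : ∃ M, ∀ x, ‖polyExp P Q x‖ ≤ M := by
  obtain ⟨M, hM⟩ := exists_norm_polynomial_eval_le_exp P
  have hM0 : 0 ≤ M := by simpa using (norm_nonneg _).trans (hM 0)
  refine ⟨M * Real.exp (K + 1 / (4 * δ)), fun x => ?_⟩
  have habs : |x| ≤ δ * x ^ 2 + 1 / (4 * δ) := by
    rw [← sub_nonneg, ← sq_abs x,
      show δ * |x| ^ 2 + 1 / (4 * δ) - |x| = δ * (|x| - 1 / (2 * δ)) ^ 2 by field_simp; ring]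
    positivity
  calc ‖polyExp P Q x‖
      = ‖P.eval (x : ℂ)‖ * Real.exp (Q.eval (x : ℂ)).re := by
        rw [polyExp, norm_mul, Complex.norm_exp]
    _ ≤ M * Real.exp |x| * Real.exp (K - δ * x ^ 2) := by
        gcongr
        exacts [hM x, hQ x]
    _ = M * Real.exp (|x| + (K - δ * x ^ 2)) := by rw [mul_assoc, ← Real.exp_add]
    _ ≤ M * Real.exp (K + 1 / (4 * δ)) := by
        exact mul_le_mul_of_nonneg_left (Real.exp_le_exp.2 (by linarith)) hM0

/-- `P(x) exp(Q(x))` as a Schwartz function, for `Q` with quadratic decay. -/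
def schwartzPolyExp (P Q : Polynomial ℂ)
    (hQ : ∃ δ K : ℝ, 0 < δ ∧ ∀ x : ℝ, (Q.eval (x : ℂ)).re ≤ K - δ * x ^ 2) : 𝓢(ℝ, ℂ) where
  toFun := polyExp P Q
  smooth' := contDiff_polyExp P Q
  decay' k n := by
    obtain ⟨R, hR⟩ := exists_iteratedDeriv_polyExp P Q n
    obtain ⟨δ, K, hδ, h⟩ := hQ
    obtain ⟨M, hM⟩ := exists_norm_polyExp_le (Polynomial.X ^ k * R) hδ h
    refine ⟨M, fun x => ?_⟩
    rw [norm_iteratedFDeriv_eq_norm_iteratedDeriv, hR]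
    refine le_of_eq_of_le ?_ (hM x)
    simp [polyExp, mul_assoc]

/-- The polynomial `a (x - c)² + b (x - c) + d`. -/
def quadPoly (c : ℝ) (a b d : ℂ) : Polynomial ℂ :=
  .C a * (.X - .C (c : ℂ)) ^ 2 + .C b * (.X - .C (c : ℂ)) + .C d

theorem eval_quadPoly (c : ℝ) (a b d : ℂ) (x : ℝ) :
    (quadPoly c a b d).eval (x : ℂ) = a * (x - c) ^ 2 + b * (x - c) + d := by
  simp [quadPoly]

theorem re_quadratic (c : ℝ) (a b d : ℂ) (x : ℝ) :
    (a * ((x : ℂ) - c) ^ 2 + b * (x - c) + d).re =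
      a.re * (x - c) ^ 2 + b.re * (x - c) + d.re := by
  rw [← Complex.ofReal_sub, ← Complex.ofReal_pow, Complex.add_re, Complex.add_re,
    Complex.re_mul_ofReal, Complex.re_mul_ofReal]

theorem exists_re_eval_quadPoly_le (c : ℝ) {a : ℂ} (ha : a.re < 0) (b d : ℂ) :
    ∃ δ K : ℝ, 0 < δ ∧ ∀ x : ℝ, ((quadPoly c a b d).eval (x : ℂ)).re ≤ K - δ * x ^ 2 := by
  obtain ⟨r, hr, hra⟩ : ∃ r : ℝ, 0 < r ∧ a.re = -r := ⟨-a.re, by linarith, by ring⟩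
  refine ⟨r / 4, d.re + b.re ^ 2 / (2 * r) + r * c ^ 2 / 2, by positivity, fun x => ?_⟩
  rw [eval_quadPoly, re_quadratic, hra, ← sub_nonneg,
    show d.re + b.re ^ 2 / (2 * r) + r * c ^ 2 / 2 - r / 4 * x ^ 2 -
      (-r * (x - c) ^ 2 + b.re * (x - c) + d.re) =
      r / 2 * ((x - c) - b.re / r) ^ 2 + r / 4 * (x - 2 * c) ^ 2 by field_simp; ring]
  positivity

/-- The Schwartz function `(p (x-c)² + q (x-c) + r) exp(a (x-c)² + b (x-c) + d)`. The quadratic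
prefactor accommodates both time and space derivatives of Gaussians. -/
def gaussianSchwartz (c : ℝ) (p q r a b d : ℂ) (ha : a.re < 0) : 𝓢(ℝ, ℂ) :=
  schwartzPolyExp (quadPoly c p q r) (quadPoly c a b d) (exists_re_eval_quadPoly_le c ha b d)

theorem gaussianSchwartz_apply (c : ℝ) (p q r a b d : ℂ) (ha : a.re < 0) (x : ℝ) :
    gaussianSchwartz c p q r a b d ha x = (p * (x - c) ^ 2 + q * (x - c) + r) *
      Complex.exp (a * (x - c) ^ 2 + b * (x - c) + d) := by
  rw [gaussianSchwartz, ← eval_quadPoly c p, ← eval_quadPoly c a]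
  rfl

theorem deriv_deriv_gaussianSchwartz (c : ℝ) (a b d : ℂ) (ha : a.re < 0) (x : ℝ) :
    deriv (deriv (gaussianSchwartz c 0 0 1 a b d ha)) x =
      ((2 * a * (x - c) + b) ^ 2 + 2 * a) * gaussianSchwartz c 0 0 1 a b d ha x := by
  have h : ⇑(gaussianSchwartz c 0 0 1 a b d ha) =
      polyExp (quadPoly c 0 0 1) (quadPoly c a b d) := rfl
  rw [h, deriv_polyExp, deriv_polyExp]
  simp [polyExp, quadPoly, Polynomial.derivative_pow]
  ring

theorem norm_gaussianSchwartz (c : ℝ) (p q r a b d : ℂ) (ha : a.re < 0) (x : ℝ) :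
    ‖gaussianSchwartz c p q r a b d ha x‖ = ‖p * ((x : ℂ) - c) ^ 2 + q * (x - c) + r‖ *
      Real.exp (a.re * (x - c) ^ 2 + b.re * (x - c) + d.re) := by
  rw [gaussianSchwartz_apply, norm_mul, Complex.norm_exp, re_quadratic]

theorem norm_gaussianSchwartz_le {c δ K : ℝ} {p q r a b d : ℂ} (ha : a.re < 0) (haδ : a.re ≤ -δ)
    (hp : ‖p‖ ≤ K) (hq : ‖q‖ ≤ K) (hr : ‖r‖ ≤ K) (hb : ‖b‖ ≤ K) (hd : ‖d‖ ≤ K) (x : ℝ) :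
    ‖gaussianSchwartz c p q r a b d ha x‖ ≤ K * ((x - c) ^ 2 + |x - c| + 1) *
      Real.exp (-δ * (x - c) ^ 2 + K * |x - c| + K) := by
  have hy : ‖(x : ℂ) - c‖ = |x - c| := by
    rw [← Complex.ofReal_sub, Complex.norm_real, Real.norm_eq_abs]
  have hpoly : ‖p * ((x : ℂ) - c) ^ 2 + q * (x - c) + r‖ ≤ K * ((x - c) ^ 2 + |x - c| + 1) :=
    calc ‖p * ((x : ℂ) - c) ^ 2 + q * (x - c) + r‖
        ≤ ‖p‖ * (x - c) ^ 2 + ‖q‖ * |x - c| + ‖r‖ := by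
          refine norm_add₃_le.trans_eq ?_
          rw [norm_mul, norm_mul, norm_pow, hy, sq_abs]
      _ ≤ K * (x - c) ^ 2 + K * |x - c| + K := by gcongr
      _ = K * ((x - c) ^ 2 + |x - c| + 1) := by ring
  have hbx : b.re * (x - c) ≤ K * |x - c| := by
    refine (le_abs_self _).trans ?_
    rw [abs_mul]
    gcongr
    exact (Complex.abs_re_le_norm b).trans hb
  have hK : 0 ≤ K := (norm_nonneg b).trans hb
  rw [norm_gaussianSchwartz]
  gcongr
  exact (Complex.re_le_norm d).trans hd

/- The envelope is a Schwartz Gaussian on either side of `c`: replace `|x - c|` by `±(x - c)`. -/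
theorem envelope_le_norm_gaussianSchwartz_add (c K : ℝ) {δ : ℝ} (hδ : (-δ : ℂ).re < 0) (x : ℝ) :
    K * ((x - c) ^ 2 + |x - c| + 1) * Real.exp (-δ * (x - c) ^ 2 + K * |x - c| + K) ≤
      ‖gaussianSchwartz c K K K (-δ) K K hδ x‖ +
        ‖gaussianSchwartz c K (-K) K (-δ) (-K) K hδ x‖ := by
  have hre (r s : ℝ) : ‖(K : ℂ) * ((x : ℂ) - c) ^ 2 + r * (x - c) + s‖ =
      |K * (x - c) ^ 2 + r * (x - c) + s| := by
    rw [← Real.norm_eq_abs, ← Complex.norm_real]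
    push_cast
    rfl
  rw [norm_gaussianSchwartz, norm_gaussianSchwartz, ← Complex.ofReal_neg, ← Complex.ofReal_neg,
    hre, hre]
  simp only [Complex.ofReal_re]
  rcases abs_cases (x - c) with ⟨h, -⟩ | ⟨h, -⟩ <;> rw [h]
  · refine le_add_of_le_of_nonneg ?_ (by positivity)
    gcongr
    exact (le_of_eq (by ring)).trans (le_abs_self _)
  · refine le_add_of_nonneg_of_le (by positivity) (mul_le_mul ?_ (le_of_eq (by ring_nf)) ?_ ?_)
    · exact (le_of_eq (by ring)).trans (le_abs_self _)
    · positivity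
    · positivity

theorem hasDerivAt_gaussianSchwartz_apply {a b d : ℝ → ℂ} (c : ℝ) (ha : ∀ t, (a t).re < 0)
    {a' b' d' : ℂ} {t : ℝ} (hda : HasDerivAt a a' t) (hdb : HasDerivAt b b' t)
    (hdd : HasDerivAt d d' t) (x : ℝ) :
    HasDerivAt (fun s => gaussianSchwartz c 0 0 1 (a s) (b s) (d s) (ha s) x)
      (gaussianSchwartz c a' b' d' (a t) (b t) (d t) (ha t) x) t := by
  simp only [gaussianSchwartz_apply, zero_mul, zero_add, one_mul]
  refine (((hda.mul_const _).add (hdb.mul_const _)).add hdd).cexp.congr_deriv ?_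
  simp only [Pi.add_apply]
  ring

theorem hasDerivAt_gaussianSchwartz_toLp {a b d a' b' d' : ℝ → ℂ} (c : ℝ)
    (ha : ∀ t, (a t).re < 0) (hda : ∀ t, HasDerivAt a (a' t) t) (hdb : ∀ t, HasDerivAt b (b' t) t)
    (hdd : ∀ t, HasDerivAt d (d' t) t) (hca : Continuous a') (hcb : Continuous b')
    (hcd : Continuous d') (t : ℝ) :
    HasDerivAt (fun s => (gaussianSchwartz c 0 0 1 (a s) (b s) (d s) (ha s)).toLp 2 volume)
      ((gaussianSchwartz c (a' t) (b' t) (d' t) (a t) (b t) (d t) (ha t)).toLp 2 volume) t := by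
  have ca : Continuous a := continuous_iff_continuousAt.2 fun s => (hda s).continuousAt
  have cb : Continuous b := continuous_iff_continuousAt.2 fun s => (hdb s).continuousAt
  have cd : Continuous d := continuous_iff_continuousAt.2 fun s => (hdd s).continuousAt
  obtain ⟨K, hK⟩ := (isCompact_closedBall t 1).exists_bound_of_continuousOn
    (f := fun s => ‖b s‖ + ‖d s‖ + ‖a' s‖ + ‖b' s‖ + ‖d' s‖)
    (Continuous.continuousOn (by fun_prop))
  obtain ⟨s₀, -, hs₀⟩ := (isCompact_closedBall t 1).exists_isMaxOn
    ⟨t, Metric.mem_closedBall_self zero_le_one⟩ (Complex.continuous_re.comp ca).continuousOn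
  have hδ : (-((-(a s₀).re : ℝ) : ℂ)).re < 0 := by simpa using ha s₀
  refine hasDerivAt_toLp_of_dominated ENNReal.ofNat_ne_top
    (f := fun s => gaussianSchwartz c 0 0 1 (a s) (b s) (d s) (ha s))
    (f' := fun s => gaussianSchwartz c (a' s) (b' s) (d' s) (a s) (b s) (d s) (ha s))
    (fun s => SchwartzMap.memLp _ 2 volume) (SchwartzMap.memLp _ 2 volume)
    ((((gaussianSchwartz c K K K _ K K hδ).memLp 2 volume).norm).add
      (((gaussianSchwartz c K (-K) K _ (-K) K hδ).memLp 2 volume).norm))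
    (Metric.closedBall_mem_nhds t one_pos) (convex_closedBall t 1)
    (fun s _ x => hasDerivAt_gaussianSchwartz_apply c ha (hda s) (hdb s) (hdd s) x)
    (fun s hs x => ?_)
  have hbound := (le_abs_self _).trans (hK s hs)
  have := norm_nonneg (b s)
  have := norm_nonneg (d s)
  have := norm_nonneg (a' s)
  have := norm_nonneg (b' s)
  have := norm_nonneg (d' s)
  refine (norm_gaussianSchwartz_le (ha s) ?_ ?_ ?_ ?_ ?_ ?_ x).trans
    (envelope_le_norm_gaussianSchwartz_add c K hδ x)
  · simpa using hs₀ hs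
  all_goals linarith

section WeakDerivative

variable {𝕜 E : Type*} [RCLike 𝕜] [NormedAddCommGroup E] [InnerProductSpace 𝕜 E] [NormedSpace ℝ E]
  [IsScalarTower ℝ 𝕜 E]

open Asymptotics in
theorem hasDerivAt_inner_of_weak {f g : ℝ → E} {f' : E} {D : 𝕜} {t C : ℝ} (hf : HasDerivAt f f' t)
    (hg : ∀ s, ‖g s‖ ≤ C) (hcont : ContinuousAt (fun s => inner 𝕜 f' (g s)) t)
    (hweak : HasDerivAt (fun s => inner 𝕜 (f t) (g s)) D t) :
    HasDerivAt (fun s => inner 𝕜 (f s) (g s)) (inner 𝕜 f' (g t) + D) t := by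
  rw [hasDerivAt_iff_isLittleO] at hf hweak ⊢
  have hstrong : (fun s => inner 𝕜 (f s - f t - (s - t) • f') (g s)) =o[𝓝 t] fun s => s - t := by
    refine (IsBigO.of_bound C (.of_forall fun s => ?_)).trans_isLittleO hf
    rw [mul_comm]
    exact (norm_inner_le_norm _ _).trans (by gcongr; exact hg s)
  have hdiff : (fun s => (s - t) • (inner 𝕜 f' (g s) - inner 𝕜 f' (g t))) =o[𝓝 t]
      fun s => s - t := by
    simpa using (isBigO_refl (fun s => s - t) (𝓝 t)).smul_isLittleO
      ((isLittleO_one_iff ℝ).2 (tendsto_sub_nhds_zero_iff.2 hcont))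
  refine ((hstrong.add hdiff).add hweak).congr_left fun s => ?_
  rw [inner_sub_left, inner_sub_left, inner_smul_left_eq_smul]
  module

end WeakDerivative

section Hamiltonian

variable {hbar m : ℝ} {V : ℝ → ℝ}

theorem integral_conj_mul_deriv_deriv (φ g : 𝓢(ℝ, ℂ)) :
    ∫ x, conj (φ x) * deriv (deriv g) x = ∫ x, conj (deriv (deriv φ) x) * g x := by
  let L : ℂ →L[ℝ] ℂ →L[ℝ] ℂ :=
    (ContinuousLinearMap.mul ℝ ℂ).comp Complex.conjCLE.toContinuousLinearMap
  have hparts (u v : 𝓢(ℝ, ℂ)) :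
      ∫ x, conj (u x) * deriv v x = -∫ x, conj (deriv u x) * v x := by
    simpa [L] using SchwartzMap.integral_bilinear_deriv_right_eq_neg_left u v L
  exact (hparts φ (SchwartzMap.derivCLM ℂ ℂ g)).trans
    (neg_eq_iff_eq_neg.2 (hparts (SchwartzMap.derivCLM ℂ ℂ φ) g))

theorem integral_conj_mul_eq_inner (φ : 𝓢(ℝ, ℂ)) (f : LineHilbert) :
    ∫ x, conj (φ x) * f x = ⟪φ.toLp 2 volume, f⟫_ℂ :=
  (inner_toLp_left _ _).symm

theorem integrable_conj_mul_schwartz (φ g : 𝓢(ℝ, ℂ)) : Integrable fun x => conj (φ x) * g x := by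
  refine (integrable_conj_mul (φ.toLp 2 volume) (g.toLp 2 volume)).congr ?_
  filter_upwards [φ.coeFn_toLp 2 volume, g.coeFn_toLp 2 volume] with x hφ hg
  rw [hφ, hg]

theorem integral_conj_hamiltonian_mul (φ : 𝓢(ℝ, ℂ)) {g k : 𝓢(ℝ, ℂ)}
    (hk : ∀ x, hamiltonian hbar m V g x = k x) :
    ∫ x, conj (hamiltonian hbar m V φ x) * g x = ∫ x, conj (φ x) * k x := by
  let D := SchwartzMap.derivCLM ℂ ℂ
  let T : ℂ := -(hbar ^ 2 / (2 * m) : ℝ)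
  have hsplit (x : ℝ) : conj (hamiltonian hbar m V φ x) * g x = conj (φ x) * k x +
      (T * (conj (D (D φ) x) * g x) - T * (conj (φ x) * D (D g) x)) := by
    rw [← hk x]
    change conj (T * D (D φ) x + V x * φ x) * g x = conj (φ x) * (T * D (D g) x + V x * g x) + _
    simp only [T, map_add, map_mul, map_neg, Complex.conj_ofReal]
    ring
  have hφ : Integrable fun x => T * (conj (D (D φ) x) * g x) :=
    (integrable_conj_mul_schwartz (D (D φ)) g).const_mul T
  have hg : Integrable fun x => T * (conj (φ x) * D (D g) x) :=
    (integrable_conj_mul_schwartz φ (D (D g))).const_mul T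
  have hDD : ∫ x, conj (φ x) * D (D g) x = ∫ x, conj (D (D φ) x) * g x :=
    integral_conj_mul_deriv_deriv φ g
  simp only [hsplit]
  rw [integral_add (integrable_conj_mul_schwartz φ k) (by exact hφ.sub hg), integral_sub hφ hg,
    integral_const_mul, integral_const_mul, hDD, sub_self, add_zero]

end Hamiltonian

/-- `Φ` is a curve of Schwartz functions that is differentiable in `L²` with derivative `Φ'` and
solves the Schrödinger equation pointwise. -/
structure IsSchwartzSolution (hbar m : ℝ) (V : ℝ → ℝ) (Φ Φ' : ℝ → 𝓢(ℝ, ℂ)) : Prop where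
  hasDerivAt : ∀ t,
    HasDerivAt (fun s => (Φ s).toLp 2 (volume : Measure ℝ)) ((Φ' t).toLp 2 volume) t
  hamiltonian_eq : ∀ t x, hamiltonian hbar m V (Φ t) x = Complex.I * hbar * Φ' t x

namespace IsSchwartzSolution

variable {hbar m : ℝ} {V : ℝ → ℝ} {Φ Φ' : ℝ → 𝓢(ℝ, ℂ)}

theorem comp_sub_const (h : IsSchwartzSolution hbar m V Φ Φ') (T : ℝ) :
    IsSchwartzSolution hbar m V (fun t => Φ (t - T)) (fun t => Φ' (t - T)) where
  hasDerivAt t := (h.hasDerivAt (t - T)).comp_sub_const t T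
  hamiltonian_eq t := h.hamiltonian_eq (t - T)

theorem integral_conj_hamiltonian_mul_left (h : IsSchwartzSolution hbar m V Φ Φ')
    (hhbar : hbar ≠ 0) (t : ℝ) (f : LineHilbert) :
    -(Complex.I / hbar) * ∫ x, conj (hamiltonian hbar m V (Φ t) x) * f x =
      -⟪(Φ' t).toLp 2 volume, f⟫_ℂ := by
  have hhbar' : (hbar : ℂ) ≠ 0 := Complex.ofReal_ne_zero.2 hhbar
  rw [← integral_conj_mul_eq_inner, ← integral_const_mul, ← integral_neg]
  refine integral_congr_ae (.of_forall fun x => ?_)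
  simp only [h.hamiltonian_eq, map_mul, Complex.conj_I, Complex.conj_ofReal]
  field_simp
  linear_combination (conj (Φ' t x) * f x) * Complex.I_sq

theorem integral_conj_hamiltonian_mul_right (h : IsSchwartzSolution hbar m V Φ Φ')
    (hhbar : hbar ≠ 0) (φ : 𝓢(ℝ, ℂ)) (t : ℝ) :
    -(Complex.I / hbar) * ∫ x, conj (hamiltonian hbar m V φ x) * (Φ t).toLp 2 volume x =
      ⟪φ.toLp 2 volume, (Φ' t).toLp 2 volume⟫_ℂ := by
  have hhbar' : (hbar : ℂ) ≠ 0 := Complex.ofReal_ne_zero.2 hhbar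
  have hsymm := integral_conj_hamiltonian_mul φ (g := Φ t) (k := (Complex.I * hbar) • Φ' t)
    (h.hamiltonian_eq t)
  have hcongr : ∫ x, conj (hamiltonian hbar m V φ x) * (Φ t).toLp 2 volume x =
      ∫ x, conj (hamiltonian hbar m V φ x) * Φ t x := by
    refine integral_congr_ae ?_
    filter_upwards [(Φ t).coeFn_toLp 2 volume] with x hx
    rw [hx]
  rw [hcongr, hsymm, ← integral_conj_mul_eq_inner, ← integral_const_mul]
  refine integral_congr_ae ?_
  filter_upwards [(Φ' t).coeFn_toLp 2 volume] with x hx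
  rw [hx, _root_.smul_apply, smul_eq_mul]
  field_simp
  linear_combination -(conj (φ x) * Φ' t x) * Complex.I_sq

theorem norm_eq_norm (h : IsSchwartzSolution hbar m V Φ Φ') (hhbar : hbar ≠ 0) (s t : ℝ) :
    ‖(Φ s).toLp 2 (volume : Measure ℝ)‖ = ‖(Φ t).toLp 2 (volume : Measure ℝ)‖ := by
  have hderiv (r : ℝ) : HasDerivAt
      (fun r => ⟪(Φ r).toLp 2 (volume : Measure ℝ), (Φ r).toLp 2 volume⟫_ℂ) 0 r := by
    refine ((h.hasDerivAt r).inner ℂ (h.hasDerivAt r)).congr_deriv ?_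
    rw [← h.integral_conj_hamiltonian_mul_right hhbar, h.integral_conj_hamiltonian_mul_left hhbar,
      neg_add_cancel]
  have hconst := is_const_of_deriv_eq_zero (fun r => (hderiv r).differentiableAt)
    (fun r => (hderiv r).deriv) s t
  rw [← sq_eq_sq₀ (norm_nonneg _) (norm_nonneg _), ← inner_self_eq_norm_sq (𝕜 := ℂ),
    ← inner_self_eq_norm_sq (𝕜 := ℂ), hconst]

theorem isSchrodingerEvolution (h : IsSchwartzSolution hbar m V Φ Φ') (hhbar : hbar ≠ 0)
    (hnorm : ‖(Φ 0).toLp 2 (volume : Measure ℝ)‖ = 1) :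
    IsSchrodingerEvolution hbar m V (fun t => (Φ t).toLp 2 volume) where
  norm_eq_one t := (h.norm_eq_norm hhbar t 0).trans hnorm
  hasDerivAt φ t := by
    simp only [integral_conj_mul_eq_inner]
    refine ((hasDerivAt_const t (φ.toLp 2 (volume : Measure ℝ))).inner ℂ
      (h.hasDerivAt t)).congr_deriv ?_
    rw [h.integral_conj_hamiltonian_mul_right hhbar, inner_zero_left, add_zero]

theorem inner_eq_inner (h : IsSchwartzSolution hbar m V Φ Φ') (hhbar : hbar ≠ 0)
    {ψ : ℝ → LineHilbert} (hψ : IsSchrodingerEvolution hbar m V ψ) (s t : ℝ) :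
    ⟪(Φ s).toLp 2 volume, ψ s⟫_ℂ = ⟪(Φ t).toLp 2 volume, ψ t⟫_ℂ := by
  have hweak (φ : 𝓢(ℝ, ℂ)) (r : ℝ) := hψ.hasDerivAt φ r
  simp only [integral_conj_mul_eq_inner] at hweak
  have hderiv (r : ℝ) : HasDerivAt (fun r => ⟪(Φ r).toLp 2 volume, ψ r⟫_ℂ) 0 r := by
    refine (hasDerivAt_inner_of_weak (h.hasDerivAt r) (fun s => (hψ.norm_eq_one s).le)
      (hweak (Φ' r) r).continuousAt (hweak (Φ r) r)).congr_deriv ?_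
    rw [h.integral_conj_hamiltonian_mul_left hhbar, add_neg_cancel]
  exact is_const_of_deriv_eq_zero (fun r => (hderiv r).differentiableAt)
    (fun r => (hderiv r).deriv) s t

end IsSchwartzSolution

section Totality

open FourierTransform in
theorem ae_eq_zero_of_fourier_eq_zero {V E : Type*} [NormedAddCommGroup V]
    [InnerProductSpace ℝ V] [FiniteDimensional ℝ V] [MeasurableSpace V] [BorelSpace V]
    [NormedAddCommGroup E] [NormedSpace ℂ E] [CompleteSpace E] {F : V → E} (hF : Integrable F)
    (h : ∀ w, 𝓕 F w = 0) : F =ᵐ[volume] 0 := by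
  have hzero (s : 𝓢(V, ℂ)) : ∫ x, s x • F x = 0 := by
    have hselfAdjoint : ∫ x, (𝓕 (𝓕⁻ s) : 𝓢(V, ℂ)) x • F x = ∫ w, (𝓕⁻ s) w • 𝓕 F w := by
      have hflip := VectorFourier.integral_fourierIntegral_smul_eq_flip (L := innerₗ V)
        Real.continuous_fourierChar continuous_inner (𝓕⁻ s).integrable hF (μ := volume)
        (ν := volume)
      rw [flip_innerₗ] at hflip
      exact hflip
    rw [fourier_fourierInv_eq] at hselfAdjoint
    simpa [h] using hselfAdjoint
  refine ae_eq_zero_of_integral_contDiff_smul_eq_zero hF.locallyIntegrable fun g hg hgs => ?_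
  have hgs' : HasCompactSupport fun x => (g x : ℂ) :=
    hgs.comp_left (g := fun r : ℝ => (r : ℂ)) Complex.ofReal_zero
  exact hzero (hgs'.toSchwartzMap (Complex.ofRealCLM.contDiff.comp hg))

theorem eq_zero_of_inner_gaussianSchwartz_eq_zero (c : ℝ) {a : ℂ} (ha : a.re < 0)
    {f : LineHilbert}
    (h : ∀ ξ : ℝ, ⟪(gaussianSchwartz c 0 0 1 a (Complex.I * ξ) 0 ha).toLp 2 volume, f⟫_ℂ = 0) :
    f = 0 := by
  have hF : Integrable fun x : ℝ => conj (Complex.exp (a * (x - c) ^ 2)) * f x := by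
    refine (integrable_conj_mul ((gaussianSchwartz c 0 0 1 a 0 0 ha).toLp 2 volume) f).congr ?_
    filter_upwards [(gaussianSchwartz c 0 0 1 a 0 0 ha).coeFn_toLp 2 volume] with x hx
    rw [hx, gaussianSchwartz_apply]
    simp
  have hzero := ae_eq_zero_of_fourier_eq_zero hF fun w => ?_
  · rw [Lp.eq_zero_iff_ae_eq_zero]
    filter_upwards [hzero] with x hx
    simpa using hx
  · have hw := h (2 * Real.pi * w)
    rw [← integral_conj_mul_eq_inner] at hw
    rw [Real.fourier_real_eq_integral_exp_smul,
      ← mul_zero (Complex.exp (-(Complex.I * (2 * Real.pi * w) * c))), ← hw, ← integral_const_mul]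
    refine integral_congr_ae (.of_forall fun x => ?_)
    simp only [gaussianSchwartz_apply, ← Complex.exp_conj, smul_eq_mul, zero_mul, zero_add, one_mul,
      add_zero, map_add, map_mul, map_sub, map_pow, Complex.conj_I, Complex.conj_ofReal,
      ← mul_assoc, ← Complex.exp_add]
    congr 2
    push_cast
    ring

end Totality

section QuadraticPotential

variable {hbar m k w : ℝ}

/-- A complex solution `u`, with velocity `v`, of the classical equation of motion `u'' = k u` in
the potential `-(m k / 2) x ^ 2`, starting from `u 0 = 1` and `v 0 = i w`. Such a solution
determines the Gaussian solutions of the Schrödinger equation in that potential. -/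
structure IsComplexMode (k w : ℝ) (u v : ℝ → ℂ) : Prop where
  hasDerivAt_position : ∀ t, HasDerivAt u (v t) t
  hasDerivAt_velocity : ∀ t, HasDerivAt v (k * u t) t
  position_zero : u 0 = 1
  velocity_zero : v 0 = Complex.I * w

/-- The coefficient `(i m / 2ħ) v / u` of `(x - c) ^ 2` in the exponent of the Gaussian solutions
attached to the complex mode `u` with velocity `v`. -/
def modeQuadCoeff (hbar m : ℝ) (u v : ℝ → ℂ) (t : ℝ) : ℂ :=
  Complex.I * (m / (2 * hbar) : ℝ) * (v t / u t)

namespace IsComplexMode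

variable {u v : ℝ → ℂ}

theorem wronskian (h : IsComplexMode k w u v) (t : ℝ) :
    conj (u t) * v t - u t * conj (v t) = 2 * w * Complex.I := by
  have hderiv (s : ℝ) :
      HasDerivAt (fun s => conj (u s) * v s - u s * conj (v s)) 0 s := by
    have hu := h.hasDerivAt_position s
    have hv := h.hasDerivAt_velocity s
    refine ((hu.star.fun_mul hv).fun_sub (hu.fun_mul hv.star)).congr_deriv ?_
    simp only [Complex.star_def, map_mul, Complex.conj_ofReal]
    ring
  refine (is_const_of_deriv_eq_zero (fun s => (hderiv s).differentiableAt)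
    (fun s => (hderiv s).deriv) t 0).trans ?_
  simp only [h.position_zero, h.velocity_zero, map_one, map_mul, Complex.conj_I,
    Complex.conj_ofReal]
  ring

theorem im_conj_mul (h : IsComplexMode k w u v) (t : ℝ) : (conj (u t) * v t).im = w := by
  have him := congrArg Complex.im (h.wronskian t)
  simp only [Complex.sub_im, Complex.mul_im, Complex.conj_re, Complex.conj_im, Complex.mul_re,
    Complex.re_ofNat, Complex.im_ofNat, Complex.ofReal_re, Complex.ofReal_im, Complex.I_re,
    Complex.I_im] at him ⊢
  linarith

theorem position_ne_zero (h : IsComplexMode k w u v) (hw : w ≠ 0) (t : ℝ) : u t ≠ 0 := by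
  intro hu
  simpa [hu, hw.symm] using h.im_conj_mul t

theorem re_modeQuadCoeff (h : IsComplexMode k w u v) (t : ℝ) :
    (modeQuadCoeff hbar m u v t).re = -(m / (2 * hbar) * (w / ‖u t‖ ^ 2)) := by
  rw [modeQuadCoeff, mul_assoc, Complex.I_mul_re, Complex.im_ofReal_mul, div_eq_mul_inv (v t),
    Complex.inv_def, ← mul_assoc, mul_comm (v t), Complex.im_mul_ofReal, h.im_conj_mul,
    Complex.normSq_eq_norm_sq, div_eq_mul_inv w]

theorem re_modeQuadCoeff_neg (h : IsComplexMode k w u v) (hhbar : 0 < hbar) (hm : 0 < m)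
    (hw : 0 < w) (t : ℝ) : (modeQuadCoeff hbar m u v t).re < 0 := by
  have hu := norm_pos_iff.2 (h.position_ne_zero hw.ne' t)
  rw [h.re_modeQuadCoeff]
  exact neg_neg_of_pos (by positivity)

theorem modeQuadCoeff_zero (h : IsComplexMode k w u v) :
    modeQuadCoeff hbar m u v 0 = (-(m / (2 * hbar) * w) : ℝ) := by
  rw [modeQuadCoeff, h.position_zero, h.velocity_zero]
  push_cast
  linear_combination (m / (2 * hbar) * w : ℂ) * Complex.I_sq

theorem hasDerivAt_modeQuadCoeff (h : IsComplexMode k w u v) (hhbar : hbar ≠ 0) (hm : m ≠ 0)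
    {t : ℝ} (hu : u t ≠ 0) :
    HasDerivAt (modeQuadCoeff hbar m u v)
      (2 * Complex.I * hbar / m * modeQuadCoeff hbar m u v t ^ 2 +
        Complex.I * m * k / (2 * hbar)) t := by
  have hhbar' : (hbar : ℂ) ≠ 0 := Complex.ofReal_ne_zero.2 hhbar
  have hm' : (m : ℂ) ≠ 0 := Complex.ofReal_ne_zero.2 hm
  refine (((h.hasDerivAt_velocity t).div (h.hasDerivAt_position t) hu).const_mul
    (Complex.I * (m / (2 * hbar) : ℝ))).congr_deriv ?_
  rw [modeQuadCoeff]
  push_cast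
  field_simp
  linear_combination -(v t ^ 2) * Complex.I_sq

theorem hasDerivAt_const_div_position (h : IsComplexMode k w u v) (hhbar : hbar ≠ 0) (hm : m ≠ 0)
    (b₀ : ℂ) {t : ℝ} (hu : u t ≠ 0) :
    HasDerivAt (fun s => b₀ / u s)
      (2 * Complex.I * hbar / m * modeQuadCoeff hbar m u v t * (b₀ / u t)) t := by
  have hhbar' : (hbar : ℂ) ≠ 0 := Complex.ofReal_ne_zero.2 hhbar
  have hm' : (m : ℂ) ≠ 0 := Complex.ofReal_ne_zero.2 hm
  refine ((hasDerivAt_const t b₀).fun_div (h.hasDerivAt_position t) hu).congr_deriv ?_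
  rw [modeQuadCoeff]
  push_cast
  field_simp
  linear_combination -(v t * b₀) * Complex.I_sq

end IsComplexMode

variable {V : ℝ → ℝ} {c E : ℝ}

theorem hamiltonian_gaussianSchwartz (hhbar : hbar ≠ 0) (hm : m ≠ 0)
    (hV : ∀ x, V x = E - m * k / 2 * (x - c) ^ 2) {a : ℂ} (b d : ℂ) (ha : a.re < 0) (x : ℝ) :
    hamiltonian hbar m V (gaussianSchwartz c 0 0 1 a b d ha) x = Complex.I * hbar *
      gaussianSchwartz c (2 * Complex.I * hbar / m * a ^ 2 + Complex.I * m * k / (2 * hbar))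
        (2 * Complex.I * hbar / m * a * b)
        (Complex.I * hbar / (2 * m) * (2 * a + b ^ 2) - Complex.I * E / hbar) a b d ha x := by
  have hhbar' : (hbar : ℂ) ≠ 0 := Complex.ofReal_ne_zero.2 hhbar
  have hm' : (m : ℂ) ≠ 0 := Complex.ofReal_ne_zero.2 hm
  rw [hamiltonian, deriv_deriv_gaussianSchwartz, hV]
  simp only [gaussianSchwartz_apply, zero_mul, zero_add, one_mul]
  push_cast
  field_simp
  ring_nf
  simp only [Complex.I_sq]
  ring

theorem IsComplexMode.exists_isSchwartzSolution {u v : ℝ → ℂ} (h : IsComplexMode k w u v)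
    (hhbar : 0 < hbar) (hm : 0 < m) (hw : 0 < w)
    (hV : ∀ x, V x = E - m * k / 2 * (x - c) ^ 2) (b₀ d₀ : ℂ) :
    ∃ d : ℝ → ℂ, d 0 = d₀ ∧ ∃ Φ' : ℝ → 𝓢(ℝ, ℂ), IsSchwartzSolution hbar m V
      (fun t => gaussianSchwartz c 0 0 1 (modeQuadCoeff hbar m u v t) (b₀ / u t) (d t)
        (h.re_modeQuadCoeff_neg hhbar hm hw t)) Φ' := by
  have hda (t : ℝ) := h.hasDerivAt_modeQuadCoeff hhbar.ne' hm.ne' (h.position_ne_zero hw.ne' t)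
  have hdb (t : ℝ) := h.hasDerivAt_const_div_position hhbar.ne' hm.ne' b₀
    (h.position_ne_zero hw.ne' t)
  have hca : Continuous (modeQuadCoeff hbar m u v) :=
    continuous_iff_continuousAt.2 fun t => (hda t).continuousAt
  have hcb : Continuous (fun t => b₀ / u t) :=
    continuous_iff_continuousAt.2 fun t => (hdb t).continuousAt
  have hcd : Continuous fun t => Complex.I * hbar / (2 * m) *
      (2 * modeQuadCoeff hbar m u v t + (b₀ / u t) ^ 2) - Complex.I * E / hbar := by fun_prop
  have hdd (t : ℝ) := (hcd.integral_hasStrictDerivAt 0 t).hasDerivAt.const_add d₀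
  refine ⟨_, by simp, _, hasDerivAt_gaussianSchwartz_toLp c
    (h.re_modeQuadCoeff_neg hhbar hm hw) hda hdb hdd (by fun_prop) (by fun_prop) hcd,
    fun t x => hamiltonian_gaussianSchwartz hhbar.ne' hm.ne' hV _ _ _ x⟩

theorem IsSchrodingerEvolution.eq_of_initial_eq {ψ χ : ℝ → LineHilbert}
    (hψ : IsSchrodingerEvolution hbar m V ψ) (hχ : IsSchrodingerEvolution hbar m V χ)
    (h0 : ψ 0 = χ 0) {u v : ℝ → ℂ} (h : IsComplexMode k w u v) (hhbar : 0 < hbar) (hm : 0 < m)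
    (hw : 0 < w) (hV : ∀ x, V x = E - m * k / 2 * (x - c) ^ 2) : ψ = χ := by
  funext T
  rw [← sub_eq_zero]
  refine eq_zero_of_inner_gaussianSchwartz_eq_zero c (h.re_modeQuadCoeff_neg hhbar hm hw 0)
    fun ξ => ?_
  obtain ⟨d, hd, Φ', hΦ⟩ :=
    h.exists_isSchwartzSolution hhbar hm hw hV (Complex.I * ξ) 0
  have hψT := (hΦ.comp_sub_const T).inner_eq_inner hhbar.ne' hψ T 0
  have hχT := (hΦ.comp_sub_const T).inner_eq_inner hhbar.ne' hχ T 0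
  simp only [sub_self, h.position_zero, div_one, hd] at hψT hχT
  rw [inner_sub_right, hψT, hχT, h0, sub_self]

theorem exp_quadratic_eq_mul_gaussianWave {σ : ℝ} (hσ : σ ≠ 0) (c q : ℝ) {a b : ℂ} (d : ℂ)
    (ha : a.re = -(1 / (4 * σ ^ 2))) (hb : (b + 2 * a * q).re = 0) (x : ℝ) :
    Complex.exp (a * (x - c) ^ 2 + b * (x - c) + d) =
      ((2 * Real.pi * σ ^ 2) ^ (1 / 4 : ℝ) * Real.exp (d + b * q + a * q ^ 2).re : ℝ) *
        gaussianWave σ (c + q) a.im (b + 2 * a * q).im (d + b * q + a * q ^ 2).im x := by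
  have hvertex : a * ((x : ℂ) - c) ^ 2 + b * (x - c) + d =
      a * ((x - (c + q) : ℝ) : ℂ) ^ 2 + (b + 2 * a * q) * ((x - (c + q) : ℝ) : ℂ) +
        (d + b * q + a * q ^ 2) := by
    push_cast
    ring
  have hN : ((2 * Real.pi * σ ^ 2) ^ (1 / 4 : ℝ) : ℝ) ≠ 0 := by positivity
  rw [hvertex, gaussianWave]
  generalize b + 2 * a * q = B at *
  generalize d + b * q + a * q ^ 2 = D at *
  generalize x - (c + q) = y
  rw [← mul_assoc, ← Complex.ofReal_mul, mul_mul_mul_comm, mul_one_div_cancel hN, one_mul,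
    ← Real.exp_add, Complex.ofReal_exp, ← Complex.exp_add, ← Complex.ofReal_pow]
  congr 1
  apply Complex.ext
  · simp only [Complex.add_re, Complex.ofReal_re, Complex.re_mul_ofReal, Complex.I_re, ha, hb]
    ring
  · simp only [Complex.add_im, Complex.ofReal_im, Complex.im_mul_ofReal, Complex.I_im]
    ring

theorem toLp_gaussianSchwartz_eq_smul_gaussianPacket {σ : ℝ} (hσ : σ ≠ 0) (c q : ℝ) {a b : ℂ}
    (d : ℂ) (ha : a.re < 0) (haσ : a.re = -(1 / (4 * σ ^ 2))) (hb : (b + 2 * a * q).re = 0) :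
    (gaussianSchwartz c 0 0 1 a b d ha).toLp 2 volume =
      ((2 * Real.pi * σ ^ 2) ^ (1 / 4 : ℝ) * Real.exp (d + b * q + a * q ^ 2).re : ℝ) •
        gaussianPacket σ (c + q) a.im (b + 2 * a * q).im (d + b * q + a * q ^ 2).im := by
  rw [gaussianPacket, ← MemLp.toLp_const_smul, SchwartzMap.toLp, MemLp.toLp_eq_toLp_iff]
  refine .of_forall fun x => ?_
  rw [gaussianSchwartz_apply, Pi.smul_apply, Complex.real_smul,
    ← exp_quadratic_eq_mul_gaussianWave hσ c q d haσ hb]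
  simp

theorem exists_toLp_gaussianSchwartz_eq_gaussianPacket {σ : ℝ} (hσ : 0 < σ) (c q : ℝ) {a b d : ℂ}
    (ha : a.re < 0) (haσ : a.re = -(1 / (4 * σ ^ 2))) (hb : (b + 2 * a * q).re = 0)
    (hnorm : ‖(gaussianSchwartz c 0 0 1 a b d ha).toLp 2 (volume : Measure ℝ)‖ = 1) :
    ∃ α β γ : ℝ, (gaussianSchwartz c 0 0 1 a b d ha).toLp 2 volume =
      gaussianPacket σ (c + q) α β γ := by
  have hsmul := toLp_gaussianSchwartz_eq_smul_gaussianPacket hσ.ne' c q d ha haσ hb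
  rw [hsmul, norm_smul, norm_gaussianPacket hσ, mul_one,
    Real.norm_of_nonneg (by positivity)] at hnorm
  exact ⟨_, _, _, by rw [hsmul, hnorm, one_smul]⟩

theorem toLp_gaussianSchwartz_eq_gaussianPacket {σ : ℝ} (hσ : 0 < σ) (c q : ℝ) {a b d : ℂ}
    (ha : a = (-(1 / (4 * σ ^ 2)) : ℝ)) (hb : b = (q / (2 * σ ^ 2) : ℝ))
    (hd : d = (-(q ^ 2 / (4 * σ ^ 2)) - Real.log ((2 * Real.pi * σ ^ 2) ^ (1 / 4 : ℝ)) : ℝ))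
    (ha' : a.re < 0) :
    (gaussianSchwartz c 0 0 1 a b d ha').toLp 2 volume = gaussianPacket σ (c + q) 0 0 0 := by
  have hlin : b + 2 * a * q = 0 := by
    rw [ha, hb]
    push_cast
    field_simp
    ring
  have hconst : d + b * q + a * q ^ 2 =
      (-Real.log ((2 * Real.pi * σ ^ 2) ^ (1 / 4 : ℝ)) : ℝ) := by
    rw [ha, hb, hd]
    push_cast
    field_simp
    ring
  rw [toLp_gaussianSchwartz_eq_smul_gaussianPacket hσ.ne' c q d ha' (by rw [ha, Complex.ofReal_re])
    (by rw [hlin, Complex.zero_re]), hlin, hconst, Complex.ofReal_re, Real.exp_neg,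
    Real.exp_log (by positivity), mul_inv_cancel₀ (by positivity), one_smul, ha]
  rfl

theorem IsComplexMode.exists_gaussianPacket_evolution {u v : ℝ → ℂ} {σ₀ : ℝ}
    (h : IsComplexMode k (hbar / (2 * m * σ₀ ^ 2)) u v) (hhbar : 0 < hbar) (hm : 0 < m)
    (hσ₀ : 0 < σ₀) (hV : ∀ x, V x = E - m * k / 2 * (x - c) ^ 2) (q₀ : ℝ) :
    ∃ ψ : ℝ → LineHilbert, IsSchrodingerEvolution hbar m V ψ ∧
      ψ 0 = gaussianPacket σ₀ (c + q₀) 0 0 0 ∧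
      ∀ t, ∃ α β γ : ℝ, ψ t = gaussianPacket (σ₀ * ‖u t‖) (c + q₀ * (u t).re) α β γ := by
  have hw : 0 < hbar / (2 * m * σ₀ ^ 2) := by positivity
  obtain ⟨d, hd, Φ', hΦ⟩ := h.exists_isSchwartzSolution hhbar hm hw hV
    (q₀ / (2 * σ₀ ^ 2) : ℝ)
    (-(q₀ ^ 2 / (4 * σ₀ ^ 2)) - Real.log ((2 * Real.pi * σ₀ ^ 2) ^ (1 / 4 : ℝ)) : ℝ)
  have hinit := toLp_gaussianSchwartz_eq_gaussianPacket hσ₀ c q₀ (a := modeQuadCoeff hbar m u v 0)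
    (by
      rw [h.modeQuadCoeff_zero]
      congr 2
      field_simp
      norm_num)
    (b := (q₀ / (2 * σ₀ ^ 2) : ℝ) / u 0) (by rw [h.position_zero, div_one]) hd
    (h.re_modeQuadCoeff_neg hhbar hm hw 0)
  have hψ := hΦ.isSchrodingerEvolution hhbar.ne' (by rw [hinit, norm_gaussianPacket hσ₀])
  refine ⟨_, hψ, hinit, fun t => ?_⟩
  have hu := norm_pos_iff.2 (h.position_ne_zero hw.ne' t)
  have hre : (modeQuadCoeff hbar m u v t).re = -(1 / (4 * (σ₀ * ‖u t‖) ^ 2)) := by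
    rw [h.re_modeQuadCoeff]
    field_simp
    norm_num
  refine exists_toLp_gaussianSchwartz_eq_gaussianPacket (mul_pos hσ₀ hu) c (q₀ * (u t).re) _ hre
    ?_ (hψ.norm_eq_one t)
  rw [Complex.add_re, Complex.re_mul_ofReal, ← Complex.ofReal_ofNat, Complex.re_ofReal_mul, hre,
    Complex.div_re, Complex.ofReal_re, Complex.ofReal_im, Complex.normSq_eq_norm_sq]
  field_simp
  ring

end QuadraticPotential

section NewtonianPotential

/-- The complex mode `cosh κt + i (w / κ) sinh κt` of the inverted oscillator `u'' = κ² u`. -/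
def hyperbolicMode (κ w t : ℝ) : ℂ :=
  (Real.cosh (κ * t) : ℝ) + (w / κ * Real.sinh (κ * t) : ℝ) * Complex.I

theorem isComplexMode_hyperbolicMode {κ : ℝ} (hκ : κ ≠ 0) (w : ℝ) :
    IsComplexMode (κ ^ 2) w (hyperbolicMode κ w)
      fun t => (κ * Real.sinh (κ * t) : ℝ) + (w * Real.cosh (κ * t) : ℝ) * Complex.I := by
  have hlin (t : ℝ) : HasDerivAt (fun s => κ * s) κ t := by
    simpa using (hasDerivAt_id t).const_mul κ
  refine ⟨fun t => ?_, fun t => ?_, by simp [hyperbolicMode], by simp [mul_comm]⟩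
  · refine ((hlin t).cosh.ofReal_comp.fun_add
      (((hlin t).sinh.const_mul (w / κ)).ofReal_comp.mul_const Complex.I)).congr_deriv ?_
    congr 2
    · rw [mul_comm]
    · congr 1
      field_simp
  · refine (((hlin t).sinh.const_mul κ).ofReal_comp.fun_add
      (((hlin t).cosh.const_mul w).ofReal_comp.mul_const Complex.I)).congr_deriv ?_
    have hκ' : (κ : ℂ) ≠ 0 := Complex.ofReal_ne_zero.2 hκ
    rw [hyperbolicMode]
    push_cast
    field_simp

theorem re_hyperbolicMode (κ w t : ℝ) : (hyperbolicMode κ w t).re = Real.cosh (κ * t) := by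
  simp [hyperbolicMode, -Complex.ofReal_cosh, -Complex.ofReal_sinh]

theorem norm_hyperbolicMode (κ w t : ℝ) : ‖hyperbolicMode κ w t‖ =
    √(Real.cosh (κ * t) ^ 2 + (w / κ * Real.sinh (κ * t)) ^ 2) := by
  rw [hyperbolicMode, Complex.norm_add_mul_I]

variable {hbar G m M x₀ σ₀ : ℝ}

theorem newtonRate_pos (hG : 0 < G) (hM : 0 < M) (hx₀ : 0 < x₀) : 0 < newtonRate G M x₀ :=
  Real.sqrt_pos.2 (by positivity)

theorem newtonWidth_pos (hσ₀ : 0 < σ₀) (t : ℝ) : 0 < newtonWidth hbar G m M x₀ σ₀ t := by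
  have := Real.cosh_pos (newtonRate G M x₀ * t)
  exact Real.sqrt_pos.2 (by positivity)

theorem strictMonoOn_newtonWidth (hG : 0 < G) (hM : 0 < M) (hx₀ : 0 < x₀) (hσ₀ : 0 < σ₀) :
    StrictMonoOn (newtonWidth hbar G m M x₀ σ₀) (Ici 0) := by
  intro s hs t _ hst
  have hκ := newtonRate_pos hG hM hx₀
  have hκs : 0 ≤ newtonRate G M x₀ * s := mul_nonneg hκ.le hs
  have hκst : newtonRate G M x₀ * s < newtonRate G M x₀ * t := mul_lt_mul_of_pos_left hst hκ
  have hcosh := Real.cosh_strictMonoOn hκs (hκs.trans hκst.le) hκst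
  have := Real.cosh_pos (newtonRate G M x₀ * s)
  have hsinh := Real.sinh_strictMono hκst
  have := Real.sinh_nonneg_iff.2 hκs
  refine Real.sqrt_lt_sqrt (by positivity) (add_lt_add_of_lt_of_le ?_ ?_) <;> gcongr

theorem newtonWidth_eq_mul_norm_hyperbolicMode (hσ₀ : 0 < σ₀) (t : ℝ) :
    newtonWidth hbar G m M x₀ σ₀ t =
      σ₀ * ‖hyperbolicMode (newtonRate G M x₀) (hbar / (2 * m * σ₀ ^ 2)) t‖ := by
  rw [norm_hyperbolicMode, newtonWidth, ← Real.sqrt_sq hσ₀.le, ← Real.sqrt_mul (sq_nonneg _),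
    Real.sqrt_sq hσ₀.le]
  congr 1
  field_simp

theorem hasDerivAt_newtonPotential {x : ℝ} (hx : x ≠ 0) :
    HasDerivAt (newtonPotential G m M) (G * m * M * (x ^ 2)⁻¹) x :=
  ((hasDerivAt_inv hx).const_mul (-(G * m * M))).congr_deriv (by ring)
    |>.congr_of_eventuallyEq (.of_forall fun y => by rw [newtonPotential]; ring)

theorem deriv_deriv_newtonPotential {x : ℝ} (hx : x ≠ 0) :
    deriv (deriv (newtonPotential G m M)) x = -(2 * G * m * M / x ^ 3) := by
  have hderiv : deriv (newtonPotential G m M) =ᶠ[𝓝 x] fun y => G * m * M * (y ^ 2)⁻¹ := by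
    filter_upwards [isOpen_ne.mem_nhds hx] with y hy using (hasDerivAt_newtonPotential hy).deriv
  rw [hderiv.deriv_eq,
    (((hasDerivAt_pow 2 x).fun_inv (pow_ne_zero 2 hx)).const_mul (G * m * M)).deriv]
  field_simp
  ring

theorem quadraticApprox_newtonPotential (hG : 0 < G) (hM : 0 < M) (hx₀ : 0 < x₀) (x : ℝ) :
    quadraticApprox (newtonPotential G m M) x₀ x =
      -(G * m * M / x₀) + m * newtonRate G M x₀ ^ 2 / 2 * (x₀ / 2) ^ 2 -
        m * newtonRate G M x₀ ^ 2 / 2 * (x - (x₀ + x₀ / 2)) ^ 2 := by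
  have hκ : newtonRate G M x₀ ^ 2 = 2 * G * M / x₀ ^ 3 := Real.sq_sqrt (by positivity)
  rw [quadraticApprox, deriv_deriv_newtonPotential hx₀.ne',
    (hasDerivAt_newtonPotential hx₀.ne').deriv, hκ, newtonPotential]
  field_simp
  ring

theorem exists_gaussianPacket_newton_evolution (hhbar : 0 < hbar) (hG : 0 < G) (hm : 0 < m)
    (hM : 0 < M) (hx₀ : 0 < x₀) (hσ₀ : 0 < σ₀) : ∃ ψ : ℝ → LineHilbert,
      IsSchrodingerEvolution hbar m (quadraticApprox (newtonPotential G m M) x₀) ψ ∧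
        ψ 0 = gaussianPacket σ₀ x₀ 0 0 0 ∧ ∀ t, ∃ α β γ : ℝ,
          ψ t = gaussianPacket (newtonWidth hbar G m M x₀ σ₀ t) (newtonCenter G M x₀ t) α β γ := by
  have hmode := isComplexMode_hyperbolicMode (newtonRate_pos hG hM hx₀).ne'
    (hbar / (2 * m * σ₀ ^ 2))
  obtain ⟨ψ, hψ, hψ0, hψt⟩ := hmode.exists_gaussianPacket_evolution hhbar hm hσ₀
    (quadraticApprox_newtonPotential hG hM hx₀) (-(x₀ / 2))
  refine ⟨ψ, hψ, by rwa [add_neg_cancel_right] at hψ0, fun t => ?_⟩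
  have hcenter : x₀ + x₀ / 2 + -(x₀ / 2) * Real.cosh (newtonRate G M x₀ * t) =
      newtonCenter G M x₀ t := by
    rw [newtonCenter]
    ring
  simpa only [← newtonWidth_eq_mul_norm_hyperbolicMode hσ₀, re_hyperbolicMode, hcenter] using hψt t

theorem newton_evolution_eq_of_initial_eq (hhbar : 0 < hbar) (hG : 0 < G) (hm : 0 < m)
    (hM : 0 < M) (hx₀ : 0 < x₀) {ψ χ : ℝ → LineHilbert}
    (hψ : IsSchrodingerEvolution hbar m (quadraticApprox (newtonPotential G m M) x₀) ψ)
    (hχ : IsSchrodingerEvolution hbar m (quadraticApprox (newtonPotential G m M) x₀) χ)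
    (h0 : ψ 0 = χ 0) : ψ = χ :=
  hψ.eq_of_initial_eq hχ h0 (isComplexMode_hyperbolicMode (newtonRate_pos hG hM hx₀).ne' 1) hhbar hm
    one_pos (quadraticApprox_newtonPotential hG hM hx₀)

end NewtonianPotential

end

theorem mainTheorem10 (hbar : ℝ) (hhbar : 0 < hbar) :
    -- the channel multiplies position kernels by the Gaussian kernel
    (∀ ℓ : ℝ, 0 < ℓ → ∀ ψ φ : LineHilbert,
      gaussianDephasing hbar ℓ (pureState ψ) φ =ᵐ[volume]
        fun x => ∫ y, (gaussianKernel ℓ (x - y) : ℂ) * (ψ x * conj (ψ y)) * φ y) ∧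
    -- value of the loss on Gaussian wavepackets
    (∀ ℓ σ c α β γ : ℝ, 0 < ℓ → 0 < σ →
      l2DephasingLoss (gaussianDephasing hbar ℓ) (pureState (gaussianPacket σ c α β γ)) =
        1 - 1 / √(1 + 4 * σ ^ 2 / ℓ ^ 2)) ∧
    -- strict monotonicity in `σ / ℓ`
    (∀ ℓ σ c α β γ ℓ' σ' c' α' β' γ' : ℝ, 0 < ℓ → 0 < σ → 0 < ℓ' → 0 < σ' → σ / ℓ < σ' / ℓ' →
      l2DephasingLoss (gaussianDephasing hbar ℓ) (pureState (gaussianPacket σ c α β γ)) <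
        l2DephasingLoss (gaussianDephasing hbar ℓ')
          (pureState (gaussianPacket σ' c' α' β' γ'))) ∧
    -- limits `σ / ℓ → 0` and `σ / ℓ → ∞`
    (∀ ℓ σ c α β γ : ℕ → ℝ, (∀ n, 0 < ℓ n) → (∀ n, 0 < σ n) →
      (Tendsto (fun n => σ n / ℓ n) atTop (𝓝 0) →
        Tendsto (fun n => l2DephasingLoss (gaussianDephasing hbar (ℓ n))
          (pureState (gaussianPacket (σ n) (c n) (α n) (β n) (γ n)))) atTop (𝓝 0)) ∧
      (Tendsto (fun n => σ n / ℓ n) atTop atTop →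
        Tendsto (fun n => l2DephasingLoss (gaussianDephasing hbar (ℓ n))
          (pureState (gaussianPacket (σ n) (c n) (α n) (β n) (γ n)))) atTop (𝓝 1))) ∧
    -- evolution in the quadratic approximation of the Newtonian potential
    (∀ G m M x₀ σ₀ : ℝ, 0 < G → 0 < m → 0 < M → 0 < x₀ → 0 < σ₀ →
      (∃! ψ : ℝ → LineHilbert,
        IsSchrodingerEvolution hbar m (quadraticApprox (newtonPotential G m M) x₀) ψ ∧
          ψ 0 = gaussianPacket σ₀ x₀ 0 0 0) ∧
      ∀ ψ : ℝ → LineHilbert,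
        IsSchrodingerEvolution hbar m (quadraticApprox (newtonPotential G m M) x₀) ψ →
        ψ 0 = gaussianPacket σ₀ x₀ 0 0 0 →
        (∀ t : ℝ, ∃ α β γ : ℝ,
          ψ t = gaussianPacket (newtonWidth hbar G m M x₀ σ₀ t) (newtonCenter G M x₀ t) α β γ) ∧
        ∀ ℓ : ℝ, 0 < ℓ →
          (∀ t : ℝ, l2DephasingLoss (gaussianDephasing hbar ℓ) (pureState (ψ t)) =
            1 - 1 / √(1 + 4 * newtonWidth hbar G m M x₀ σ₀ t ^ 2 / ℓ ^ 2)) ∧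
          StrictMonoOn
            (fun t => l2DephasingLoss (gaussianDephasing hbar ℓ) (pureState (ψ t))) (Ici 0)) := by
  refine ⟨fun ℓ hℓ => gaussianDephasing_pureState_apply_ae_eq hhbar hℓ,
    fun ℓ σ c α β γ hℓ hσ => ?_, fun ℓ σ c α β γ ℓ' σ' c' α' β' γ' hℓ hσ hℓ' hσ' hlt => ?_,
    fun ℓ σ c α β γ hℓ hσ => ?_, fun G m M x₀ σ₀ hG hm hM hx₀ hσ₀ => ?_⟩
  · rw [l2DephasingLoss_gaussianPacket hhbar hℓ hσ, gaussianLoss_div]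
  · rw [l2DephasingLoss_gaussianPacket hhbar hℓ hσ, l2DephasingLoss_gaussianPacket hhbar hℓ' hσ']
    exact strictMonoOn_gaussianLoss (div_pos hσ hℓ).le (div_pos hσ' hℓ').le hlt
  · simp only [l2DephasingLoss_gaussianPacket hhbar (hℓ _) (hσ _)]
    exact ⟨tendsto_gaussianLoss_zero.comp, tendsto_gaussianLoss_atTop.comp⟩
  obtain ⟨χ, hχ, hχ0, hχt⟩ := exists_gaussianPacket_newton_evolution hhbar hG hm hM hx₀ hσ₀
  have hunique (ψ) (hψ : IsSchrodingerEvolution hbar m _ ψ) (hψ0 : ψ 0 = _) : ψ = χ :=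
    newton_evolution_eq_of_initial_eq hhbar hG hm hM hx₀ hψ hχ (hψ0.trans hχ0.symm)
  refine ⟨⟨χ, ⟨hχ, hχ0⟩, fun ψ hψ => hunique ψ hψ.1 hψ.2⟩, fun ψ hψ hψ0 => ?_⟩
  obtain rfl := hunique ψ hψ hψ0
  refine ⟨hχt, fun ℓ hℓ => ⟨fun t => ?_, strictMonoOn_l2DephasingLoss_of_eq_gaussianPacket hhbar hℓ
    hχt (newtonWidth_pos hσ₀) (strictMonoOn_newtonWidth hG hM hx₀ hσ₀)⟩⟩
  obtain ⟨α, β, γ, hψt⟩ := hχt t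
  rw [hψt, l2DephasingLoss_gaussianPacket hhbar hℓ (newtonWidth_pos hσ₀ t), gaussianLoss_div]
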